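/- **Setting.** Let $X$ be the vertex set of a connected simplicial graph with bounded geometry (for each $r$, the balls of radius $r$ have uniformly bounded cardinality), with its path metric $d$; let $e\in X$ and let $\mathcal A=\{A_i\}_{i\in I}$ be a family of subsets (pieces) of $X$. Let $\mathcal G_{x,e}$ be the set of geodesics from $x$ to $e$. If $g\in\mathcal G_{x,e}$ meets $A_i$, let $g|_i^+$ and $g|_i^-$ be the first and the last vertex of $g$ in $A_i$ (travelling from $x$ to $e$), and put $l_i(g)=d(g|_i^-,g|_i^+)+1$. For $k\in\mathbb N$ let $G_{x,k}=\bigcup_{d(x,y)\le k}\mathcal G_{y,e}$. For a collection $G$ of geodesics ending at $e$, let $\partial_i^K(G)$ be the set of entry points $a=g|_i^+$ ($g\in G$ meeting $A_i$) such that, for all $g'\in G$ and $j\in I$ with $g'$ meeting $A_j$ and $l_j(g')\ge 5K$, $$d(e,a)\notin[\,d(e,g'|_j^-)+2K,\ d(e,g'|_j^+)-2K\,].$$ Put $\partial_i^K(x)=\bigcup_{k\le d(x,A_i)/4}\partial_i^K(G_{x,k})$, and let $I_x(K)$ be the set of $i\in I$ with $\partial_i^K(x)\ne\emptyset$ and $d(e,\partial_i^K(x))\ge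 3K$. The triple $(X,\mathcal A,e)$ is *SPQR relatively hyperbolic* if for some constant $K$: * (C1) $d(g_1|_i^-,g_2|_i^-)\le K$ for all $i$ and all geodesics $g_1,g_2$ ending at $e$ that meet $A_i$; * (C2) for all $i$, all $x,y$ with $d(x,y)\le\max\{d(x,A_i)/4,1\}$ and all $g_x\in\mathcal G_{x,e}$, $g_y\in\mathcal G_{y,e}$ with $g_x$ meeting $A_i$: if $g_y$ meets $A_i$ then $d(g_x|_i^+,g_y|_i^+)\le K$, and if $g_y\cap A_i=\emptyset$ then $l_i(g_x)\le K$; * (C3) $1\le|\{i: x\in A_i\}|\le K$ for all $x\in X$, and $\operatorname{diam}(A_i\cap A_j)\le K$ for all $i\ne j$; * (C4) $|\{i\in I_x(K): d(x,A_i)=t\}|\le K$ for all $x\in X$ and $t\in\mathbb N$. A function $h$ from $\mathbb N$ or $\mathbb R_{\ge0}$ to $\mathbb R_{\ge 0}$ is called *concave* if it is non-decreasing and $h(n+m)-h(n)\le h(n)-h(n-m)$ for all $n\ge m$. A function $f:\mathbb N\to\mathbb R_{\ge0}$ has *property $(C_p^c)$* if it is concave, $\sum_{n\ge1}\frac1n\left(\frac{f(n)}n\right)^p<\infty$,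 and $f(n)^p/n$ is non-decreasing for all sufficiently large $n$. **Theorem.** Let $(X,\mathcal A,e)$ be SPQR relatively hyperbolic and let $p>1$. Suppose that $\rho':\mathbb R_{\ge0}\to\mathbb R_{\ge0}$ is concave and that for each $i\in I$ there are a set $X_i$ and a map $\psi_i:A_i\to\ell^p(X_i)$ with $$\rho'(d(x,y))\le\|\psi_i(x)-\psi_i(y)\|_p\le d(x,y)\qquad\text{for all }x,y\in A_i .$$ Then for every $f$ with property $(C_p^c)$ there are a set $Z$, a map $\phi:X\to\ell^p(Z)$ and a constant $C$ such that for all $x,y\in X$ $$\|\phi(x)-\phi(y)\|_p\le C\,d(x,y)\quad\text{and}\quad \min\{\rho'(d(x,y)),f(d(x,y))\}\le C\,\|\phi(x)-\phi(y)\|_p+C .$$ If moreover $\rho'(r)\to\infty$ as $r\to\infty$, then $\phi$ can be chosen to be, in addition, a coarse embedding, i.e. there are $\rho_\pm:\mathbb R_{\ge0}\to\mathbb R_{\ge0}$ tending to $\infty$ at $\infty$ with $\rho_-(d(x,y))\le\|\phi(x)-\phi(y)\|_p\le\rho_+(d(x,y))$ for all $x,y\in X$. -/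

import Mathlib

open Filter
open scoped NNReal ENNReal

universe u v w

/-- Concave functions on `ℕ` or on `ℝ≥0`: `f` is non-decreasing and
`f (n + m) - f n ≤ f n - f (n - m)` whenever `m ≤ n` (written with `n = k + m`). -/
structure IsConcaveFun {S : Type*} [AddCommMonoid S] [Preorder S] (f : S → ℝ≥0) : Prop where
  mono : Monotone f
  concave : ∀ k m : S,
    (f (k + m + m) : ℝ) - (f (k + m) : ℝ) ≤ (f (k + m) : ℝ) - (f k : ℝ)

/-- Property `(C_p)`: `∑_{n ≥ 1} (1 / n) (f n / n) ^ p < ∞` (the sum is indexed by `n + 1`). -/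
def PropertyC (p : ℝ) (f : ℕ → ℝ≥0) : Prop :=
  Summable fun n : ℕ => (1 / ((n : ℝ) + 1)) * ((f (n + 1) : ℝ) / ((n : ℝ) + 1)) ^ p

/-- Property `(C_p^c)`: `f` is concave, has property `(C_p)`, and `f n ^ p / n` is non-decreasing
for all sufficiently large `n`. -/
structure PropertyCc (p : ℝ) (f : ℕ → ℝ≥0) : Prop where
  concave : IsConcaveFun f
  summable : PropertyC p f
  eventually_mono : ∃ N : ℕ, 1 ≤ N ∧ ∀ m n : ℕ, N ≤ m → m ≤ n →
    (f m : ℝ) ^ p / (m : ℝ) ≤ (f n : ℝ) ^ p / (n : ℝ)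

/-- A set is finite with at most `K` elements. -/
def CardLE {α : Type*} (s : Set α) (K : ℝ) : Prop :=
  s.Finite ∧ (s.ncard : ℝ) ≤ K

/-- A geodesic, in the graph `G`, from some vertex `start` to the basepoint `e`. -/
structure GeodesicTo {X : Type u} (G : SimpleGraph X) (e : X) where
  start : X
  walk : G.Walk start e
  isGeodesic : walk.length = G.dist start e

namespace SPQR

variable {X : Type u} {I : Type v} {G : SimpleGraph X} {e : X}

/-- The set of vertices of `g` lying in `A`. -/
def trace (g : GeodesicTo G e) (A : Set X) : Set X :=
  {a | a ∈ g.walk.support ∧ a ∈ A}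

/-- `a` is the first vertex of `g` in `A`, i.e. the initial vertex of the convex hull
in `g` of `g ∩ A`. As `g` is a geodesic ending at `e`, the distance to `e` drops by one at every
step of `g`, so this is the vertex of `g ∩ A` farthest from `e`. -/
def IsEntry (g : GeodesicTo G e) (A : Set X) (a : X) : Prop :=
  a ∈ trace g A ∧ ∀ b ∈ trace g A, G.dist e b ≤ G.dist e a

/-- `a` is the last vertex of `g` in `A`, i.e. the terminal vertex of the convex hull
in `g` of `g ∩ A`; equivalently the vertex of `g ∩ A` closest to `e`. -/
def IsExit (g : GeodesicTo G e) (A : Set X) (a : X) : Prop :=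
  a ∈ trace g A ∧ ∀ b ∈ trace g A, G.dist e a ≤ G.dist e b

/-- The distance `d(x, A)`, for nonempty `A`. All uses below concern a set `A` that is met
by some geodesic. -/
noncomputable def distTo (G : SimpleGraph X) (x : X) (A : Set X) : ℕ :=
  sInf (G.dist x '' A)

/-- All geodesics to `e` that start in the ball of radius `k` around `x`. -/
def nearGeodesics (G : SimpleGraph X) (e x : X) (k : ℕ) : Set (GeodesicTo G e) :=
  {g | G.dist x g.start ≤ k}

/-- The `i`-boundary of a collection `Γ` of geodesics: the entry points `a` into `A i` of members
of `Γ` such that `d(e, a)` does not lie in `[d(e, b) + 2K, d(e, c) - 2K]` whenever some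
`g' ∈ Γ` has exit point `b` and entry point `c` for a piece `A j` with `j`-length
`d(b, c) + 1 ≥ 5K`. -/
def boundary (A : I → Set X) (K : ℝ) (i : I) (Γ : Set (GeodesicTo G e)) : Set X :=
  {a | (∃ g ∈ Γ, IsEntry g (A i) a) ∧
    ∀ g' ∈ Γ, ∀ (j : I) (b c : X), IsExit g' (A j) b → IsEntry g' (A j) c →
      5 * K ≤ (G.dist b c : ℝ) + 1 →
      (G.dist e a : ℝ) ∉ Set.Icc ((G.dist e b : ℝ) + 2 * K) ((G.dist e c : ℝ) - 2 * K)}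

/-- The union of the `i`-boundaries of `nearGeodesics G e x k` over `k ≤ d(x, A i) / 4`. -/
def pointBoundary (G : SimpleGraph X) (e : X) (A : I → Set X) (K : ℝ) (i : I) (x : X) : Set X :=
  {a | ∃ k : ℕ, (k : ℝ) ≤ (distTo G x (A i) : ℝ) / 4 ∧ a ∈ boundary A K i (nearGeodesics G e x k)}

/-- The set of `x`-relevant indices: the boundary of `x` at `i` is nonempty and at distance at
least `3K` from `e`. -/
def relevant (G : SimpleGraph X) (e : X) (A : I → Set X) (K : ℝ) (x : X) : Set I :=
  {i | (pointBoundary G e A K i x).Nonempty ∧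
    ∀ a ∈ pointBoundary G e A K i x, 3 * K ≤ (G.dist e a : ℝ)}

/-- Exit points from a given piece are at distance at most `K` from each other. -/
def C1 (G : SimpleGraph X) (e : X) (A : I → Set X) (K : ℝ) : Prop :=
  ∀ (i : I) (g₁ g₂ : GeodesicTo G e) (b₁ b₂ : X),
    IsExit g₁ (A i) b₁ → IsExit g₂ (A i) b₂ → (G.dist b₁ b₂ : ℝ) ≤ K

/-- If `d(x, y) ≤ max {d(x, A i) / 4, 1}`, then geodesics from `x` and from `y` to `e` that meet
`A i` enter it at points at distance at most `K`; and if one from `y` misses `A i`, then those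
from `x` meeting `A i` have `i`-length at most `K`. -/
def C2 (G : SimpleGraph X) (e : X) (A : I → Set X) (K : ℝ) : Prop :=
  ∀ (i : I) (gx gy : GeodesicTo G e),
    (G.dist gx.start gy.start : ℝ) ≤ max ((distTo G gx.start (A i) : ℝ) / 4) 1 →
    (∀ a a' : X, IsEntry gx (A i) a → IsEntry gy (A i) a' → (G.dist a a' : ℝ) ≤ K) ∧
    (trace gy (A i) = ∅ → ∀ b a : X, IsExit gx (A i) b → IsEntry gx (A i) a →
      (G.dist b a : ℝ) + 1 ≤ K)

/-- Every vertex lies in at least one and at most `K` pieces, and the intersection of two distinct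
pieces has diameter at most `K`. -/
def C3 (G : SimpleGraph X) (A : I → Set X) (K : ℝ) : Prop :=
  (∀ x : X, {i | x ∈ A i}.Nonempty ∧ CardLE {i | x ∈ A i} K) ∧
  ∀ i j : I, i ≠ j → ∀ x ∈ A i ∩ A j, ∀ y ∈ A i ∩ A j, (G.dist x y : ℝ) ≤ K

/-- For every `x` and `t`, at most `K` of the `x`-relevant pieces are at distance exactly `t`
from `x`. -/
def C4 (G : SimpleGraph X) (e : X) (A : I → Set X) (K : ℝ) : Prop :=
  ∀ (x : X) (t : ℕ), CardLE {i | i ∈ relevant G e A K x ∧ distTo G x (A i) = t} K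

end SPQR

/-- Bounded geometry: balls of a given radius have uniformly bounded cardinality. -/
def BoundedGeometry {X : Type u} (G : SimpleGraph X) : Prop :=
  ∀ r : ℕ, ∃ N : ℕ, ∀ x : X, CardLE {y | G.dist x y ≤ r} N

/-- `(X, A, e)` is SPQR relatively hyperbolic: `X` is the vertex set of a connected simplicial
graph with bounded geometry and conditions (C1)-(C4) hold for a common constant `K`. -/
structure IsSPQRRelHyp {X : Type u} {I : Type v} (G : SimpleGraph X) (A : I → Set X) (e : X) :
    Prop where
  connected : G.Connected
  boundedGeometry : BoundedGeometry G
  conditions : ∃ K : ℝ,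
    SPQR.C1 G e A K ∧ SPQR.C2 G e A K ∧ SPQR.C3 G A K ∧ SPQR.C4 G e A K

/-- Coarse embeddings of the vertex set of a connected graph, with its path metric, into a
normed group. -/
def IsCoarseEmbedding {X : Type u} (G : SimpleGraph X) {E : Type*} [AddCommGroup E] [Norm E]
    (φ : X → E) : Prop :=
  ∃ ρ₁ ρ₂ : ℝ≥0 → ℝ≥0, Tendsto ρ₁ atTop atTop ∧ Tendsto ρ₂ atTop atTop ∧
    ∀ x y : X, (ρ₁ (G.dist x y : ℝ≥0) : ℝ) ≤ ‖φ x - φ y‖ ∧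
      ‖φ x - φ y‖ ≤ (ρ₂ (G.dist x y : ℝ≥0) : ℝ)

/-! Write |v| = d(e, v), D = d(x, y), and let g, g' be geodesics from x, y to e. The embedding has
one block of coordinates carrying the given maps and two blocks carrying f. All of them count radii
k in a window of size N around x, where N is comparable to d(x, A_i) + 1. The first block
(`pieceMap`) averages the displacements ψ_i(a) - ψ_i(b_i) over entry points a into A_i, where b_i is
a base point near all exits. The weight of a is the number of k < N such that the k-ball around x
contains the start of a geodesic entering at a. Between neighbours each weight changes by at most 2,
some weight is at least N, and (C2) with bounded geometry confines the relevant entry points to a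
bounded set, so the increment is O(1/N). A geodesic from x enters A_i within O(N) of x and each
vertex lies in at most K pieces, so the p-th powers sum like ∑ n^(-p), which converges as p > 1. The
other blocks are indexed by a piece and a level t. They are q(N) times the number of k < N whose
ball meets a set S but not a set B, with q(n) = f(n) / n^(1 + 1/p). Increments are O(q(N)) and ∑
q(n)^p = ∑ (1/n)(f(n)/n)^p converges, so it suffices that boundedly many coordinates are active at
each scale. For levels on long segments (`longSet`) this is a count along a single geodesic; for
entries avoiding the middle of long segments (`entrySet`, `forbidSet`) it is (C4). For the lower
bound let |y| ≤ |x| and let m be comparable to D. If g and g' enter a common piece at points at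
least m apart, or g enters a piece missed by g' at distance at least m/4 from its base point, then
the first block dominates ρ'(D). Otherwise a positive proportion of the levels of g at distance
between m and 2m from x yield distinct coordinates of order m q(m) = f(m) m^(-1/p) at x that vanish
at y (`exists_coordinate`), and together they have norm of order f(m). Concavity passes from m back
to D. For coarse embeddings f is replaced by f + √n, which is unbounded. -/

/-! ### Geodesics to the base point, parametrised by level -/

namespace GeodesicTo

variable {X : Type u} {G : SimpleGraph X} {e : X}

lemma exists_start_eq (hc : G.Connected) (e x : X) : ∃ g : GeodesicTo G e, g.start = x := by
  obtain ⟨p, hp⟩ := hc.exists_walk_length_eq_dist x e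
  exact ⟨⟨x, p, hp⟩, rfl⟩

lemma dist_start_add (hc : G.Connected) (g : GeodesicTo G e) {v : X} (hv : v ∈ g.walk.support) :
    G.dist g.start v + G.dist e v = G.dist e g.start := by
  classical
  have h1 := congrArg SimpleGraph.Walk.length (g.walk.take_spec hv)
  rw [SimpleGraph.Walk.length_append, g.isGeodesic] at h1
  have h2 := SimpleGraph.dist_le (g.walk.takeUntil v hv)
  have h3 := SimpleGraph.dist_le (g.walk.dropUntil v hv)
  have h4 := hc.dist_triangle (u := g.start) (v := v) (w := e)
  rw [G.dist_comm (u := e) (v := v), G.dist_comm (u := e) (v := g.start)]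
  omega

/-- The part of a geodesic to `e` from one of its vertices on. -/
lemma exists_tail (hc : G.Connected) (g : GeodesicTo G e) {v : X} (hv : v ∈ g.walk.support) :
    ∃ g' : GeodesicTo G e, g'.start = v ∧
      ∀ w, w ∈ g'.walk.support ↔ w ∈ g.walk.support ∧ G.dist e w ≤ G.dist e v := by
  classical
  have h1 := congrArg SimpleGraph.Walk.length (g.walk.take_spec hv)
  rw [SimpleGraph.Walk.length_append, g.isGeodesic] at h1
  have h2 := SimpleGraph.dist_le (g.walk.takeUntil v hv)
  have h3 := SimpleGraph.dist_le (g.walk.dropUntil v hv)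
  have h4 := hc.dist_triangle (u := g.start) (v := v) (w := e)
  have hg : (g.walk.dropUntil v hv).length = G.dist v e := by omega
  have ht : (g.walk.takeUntil v hv).length = G.dist g.start v := by omega
  refine ⟨⟨v, g.walk.dropUntil v hv, hg⟩, rfl, fun w => ⟨fun hw => ?_, fun hw => ?_⟩⟩
  · refine ⟨g.walk.support_dropUntil_subset_support hv hw, ?_⟩
    have := dist_start_add hc ⟨v, g.walk.dropUntil v hv, hg⟩ hw
    simp only at this
    omega
  · obtain ⟨hw, hle⟩ := hw
    have hw' := hw
    rw [← g.walk.take_spec hv, SimpleGraph.Walk.mem_support_append_iff] at hw'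
    rcases hw' with hw' | hw'
    · have h5 := congrArg SimpleGraph.Walk.length ((g.walk.takeUntil v hv).take_spec hw')
      rw [SimpleGraph.Walk.length_append, ht] at h5
      have h6 := SimpleGraph.dist_le ((g.walk.takeUntil v hv).takeUntil w hw')
      have h7 := SimpleGraph.dist_le ((g.walk.takeUntil v hv).dropUntil w hw')
      have h8 := dist_start_add hc g hv
      have h9 := dist_start_add hc g hw
      have : G.dist w v = 0 := by omega
      rw [hc.dist_eq_zero_iff] at this
      subst this
      exact SimpleGraph.Walk.start_mem_support _
    · exact hw'

lemma dist_add (hc : G.Connected) (g : GeodesicTo G e) {v w : X} (hv : v ∈ g.walk.support)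
    (hw : w ∈ g.walk.support) (h : G.dist e w ≤ G.dist e v) :
    G.dist v w + G.dist e w = G.dist e v := by
  obtain ⟨g', rfl, hg'⟩ := exists_tail hc g hv
  exact dist_start_add hc g' ((hg' w).2 ⟨hw, h⟩)

lemma eq_of_dist_eq (hc : G.Connected) (g : GeodesicTo G e) {v w : X} (hv : v ∈ g.walk.support)
    (hw : w ∈ g.walk.support) (h : G.dist e w = G.dist e v) : v = w := by
  have := dist_add hc g hv hw h.le
  rw [← hc.dist_eq_zero_iff]
  omega

lemma dist_le_start (hc : G.Connected) (g : GeodesicTo G e) {v : X} (hv : v ∈ g.walk.support) :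
    G.dist e v ≤ G.dist e g.start := by
  have := dist_start_add hc g hv
  omega

lemma exists_mem_dist_eq (hc : G.Connected) (g : GeodesicTo G e) {t : ℕ}
    (ht : t ≤ G.dist e g.start) : ∃ v ∈ g.walk.support, G.dist e v = t := by
  have hlen : g.walk.length = G.dist e g.start := by rw [g.isGeodesic, G.dist_comm]
  refine ⟨g.walk.getVert (G.dist e g.start - t), g.walk.getVert_mem_support _, ?_⟩
  have h1 := dist_start_add hc g (g.walk.getVert_mem_support (G.dist e g.start - t))
  have h2 := SimpleGraph.dist_le (g.walk.take (G.dist e g.start - t))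
  have h3 := SimpleGraph.dist_le (g.walk.drop (G.dist e g.start - t))
  rw [SimpleGraph.Walk.take_length] at h2
  rw [SimpleGraph.Walk.drop_length, G.dist_comm (v := e)] at h3
  omega

end GeodesicTo

/-! ### Entries, exits, and distances to sets -/

namespace SPQR

variable {X : Type u} {I : Type v} {G : SimpleGraph X} {e : X}

lemma trace_finite (g : GeodesicTo G e) (A : Set X) : (trace g A).Finite :=
  (List.finite_toSet g.walk.support).subset fun _ h => h.1

lemma exists_isEntry (g : GeodesicTo G e) {A : Set X} (h : trace g A ≠ ∅) :
    ∃ a, IsEntry g A a :=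
  Set.exists_max_image _ _ (trace_finite g A) (Set.nonempty_iff_ne_empty.2 h)

lemma exists_isExit (g : GeodesicTo G e) {A : Set X} (h : trace g A ≠ ∅) :
    ∃ a, IsExit g A a :=
  Set.exists_min_image _ _ (trace_finite g A) (Set.nonempty_iff_ne_empty.2 h)

lemma IsEntry.trace_ne {g : GeodesicTo G e} {A : Set X} {a : X} (h : IsEntry g A a) :
    trace g A ≠ ∅ := Set.nonempty_iff_ne_empty.1 ⟨a, h.1⟩

lemma IsEntry.exists_isExit {g : GeodesicTo G e} {A : Set X} {a : X} (h : IsEntry g A a) :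
    ∃ z, IsExit g A z := SPQR.exists_isExit g h.trace_ne

lemma IsEntry.dist_isExit (hc : G.Connected) {g : GeodesicTo G e} {A : Set X} {a z : X}
    (h : IsEntry g A a) (hz : IsExit g A z) : G.dist z a + G.dist e z = G.dist e a := by
  rw [G.dist_comm (u := z)]
  exact g.dist_add hc h.1.1 hz.1.1 (hz.2 a h.1)

lemma IsEntry.dist_start_add (hc : G.Connected) {g : GeodesicTo G e} {A : Set X} {a : X}
    (h : IsEntry g A a) : G.dist g.start a + G.dist e a = G.dist e g.start :=
  GeodesicTo.dist_start_add hc g h.1.1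

lemma isEntry_start (hc : G.Connected) {g : GeodesicTo G e} {A : Set X} (h : g.start ∈ A) :
    IsEntry g A g.start :=
  ⟨⟨g.walk.start_mem_support, h⟩, fun _ hb => g.dist_le_start hc hb.1⟩

lemma IsEntry.unique (hc : G.Connected) {g : GeodesicTo G e} {A : Set X} {a a' : X}
    (h : IsEntry g A a) (h' : IsEntry g A a') : a = a' :=
  g.eq_of_dist_eq hc h.1.1 h'.1.1 (le_antisymm (h.2 _ h'.1) (h'.2 _ h.1))

lemma distTo_le (G : SimpleGraph X) {A : Set X} (x : X) {a : X} (h : a ∈ A) :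
    distTo G x A ≤ G.dist x a :=
  Nat.sInf_le ⟨a, h, rfl⟩

lemma exists_dist_eq_distTo (G : SimpleGraph X) {A : Set X} (x : X) (h : A.Nonempty) :
    ∃ a ∈ A, G.dist x a = distTo G x A :=
  Nat.sInf_mem (h.image _)

lemma distTo_le_add (hc : G.Connected) (A : Set X) (x y : X) :
    distTo G x A ≤ distTo G y A + G.dist x y := by
  rcases A.eq_empty_or_nonempty with rfl | h
  · simp [distTo]
  · obtain ⟨a, ha, h1⟩ := exists_dist_eq_distTo G y h
    have := distTo_le G x ha
    have := hc.dist_triangle (u := x) (v := y) (w := a)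
    omega

/-- The distance from `x` to `S`, truncated at `N`. -/
noncomputable def truncDist (G : SimpleGraph X) (N : ℕ) (x : X) (S : Set X) : ℕ :=
  sInf (insert N (G.dist x '' S))

lemma truncDist_le (G : SimpleGraph X) (N : ℕ) (x : X) (S : Set X) : truncDist G N x S ≤ N :=
  Nat.sInf_le (Set.mem_insert _ _)

lemma truncDist_le_dist (G : SimpleGraph X) (N : ℕ) (x : X) {S : Set X} {y : X} (h : y ∈ S) :
    truncDist G N x S ≤ G.dist x y :=
  Nat.sInf_le (Set.mem_insert_of_mem _ ⟨y, h, rfl⟩)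

lemma truncDist_eq_zero (G : SimpleGraph X) (N : ℕ) {x : X} {S : Set X} (h : x ∈ S) :
    truncDist G N x S = 0 := by
  have := truncDist_le_dist G N x h
  simpa using this

lemma exists_dist_eq_truncDist {N : ℕ} {x : X} {S : Set X} (h : truncDist G N x S < N) :
    ∃ y ∈ S, G.dist x y = truncDist G N x S := by
  have : truncDist G N x S ∈ insert N (G.dist x '' S) := Nat.sInf_mem (Set.insert_nonempty _ _)
  rcases this with h' | h'
  · omega
  · exact h'

lemma truncDist_le_add (hc : G.Connected) (N N' c : ℕ) (x y : X) (S : Set X)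
    (hN : N ≤ N' + c) (h : G.dist x y ≤ c) : truncDist G N x S ≤ truncDist G N' y S + c := by
  rcases (truncDist_le G N' y S).lt_or_eq with h' | h'
  · obtain ⟨z, hz, h1⟩ := exists_dist_eq_truncDist h'
    have := truncDist_le_dist G N x hz
    have := hc.dist_triangle (u := x) (v := y) (w := z)
    omega
  · have := truncDist_le G N x S
    omega

end SPQR

/-! ### Coarse geometry of a piece: consequences of (C1)-(C3) -/

namespace SPQR

variable {X : Type u} {I : Type v} {G : SimpleGraph X} {e : X}

/-- Integral form of (C1)-(C3), with a chosen point `b i` near all exits from `A i`. -/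
structure PieceBounds (G : SimpleGraph X) (A : I → Set X) (e : X) (K : ℕ) (b : I → X) : Prop where
  connected : G.Connected
  one_le : 1 ≤ K
  exit_near : ∀ (i : I) (g : GeodesicTo G e) (z : X), IsExit g (A i) z → G.dist z (b i) ≤ K
  exit_exit : ∀ (i : I) (g g' : GeodesicTo G e) (z z' : X), IsExit g (A i) z →
    IsExit g' (A i) z' → G.dist z z' ≤ K
  base_mem : ∀ i, (A i).Nonempty → b i ∈ A i
  entry_near : ∀ (i : I) (g g' : GeodesicTo G e),
    (4 * G.dist g.start g'.start ≤ distTo G g.start (A i) ∨ G.dist g.start g'.start ≤ 1) →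
    ∀ a a', IsEntry g (A i) a → IsEntry g' (A i) a' → G.dist a a' ≤ K
  length_le : ∀ (i : I) (g g' : GeodesicTo G e),
    (4 * G.dist g.start g'.start ≤ distTo G g.start (A i) ∨ G.dist g.start g'.start ≤ 1) →
    trace g' (A i) = ∅ → ∀ z a, IsExit g (A i) z → IsEntry g (A i) a → G.dist z a + 1 ≤ K
  cover : ∀ x, ∃ i, x ∈ A i
  card_le : ∀ (x : X) (F : Finset I), (∀ i ∈ F, x ∈ A i) → F.card ≤ K

/-- Graph distances are integers, so K may be rounded down; it is at least 1 because every vertex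
lies in some piece. The base point `b i` is the exit of one geodesic starting in `A i`, and (C1)
puts all other exits within K of it. -/
lemma exists_pieceBounds {A : I → Set X} {K : ℝ} (hc : G.Connected) (h1 : C1 G e A K)
    (h2 : C2 G e A K) (h3 : C3 G A K) : ∃ b : I → X, PieceBounds G A e ⌊K⌋₊ b := by
  classical
  have card_le : ∀ (x : X) (F : Finset I), (∀ i ∈ F, x ∈ A i) → (F.card : ℝ) ≤ K := by
    intro x F hF
    obtain ⟨hfin, hle⟩ := (h3.1 x).2
    refine le_trans ?_ hle
    rw [← Set.ncard_coe_finset F]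
    exact_mod_cast Set.ncard_le_ncard hF hfin
  have hK1 : (1 : ℝ) ≤ K := by
    obtain ⟨i, hi⟩ := (h3.1 e).1
    simpa using card_le e {i} (by simpa using hi)
  have hK0 : 0 ≤ K := by linarith
  have hex : ∀ i : I, ∃ z : X, ((A i).Nonempty → z ∈ A i) ∧
      ∀ g : GeodesicTo G e, ∀ z', IsExit g (A i) z' → (G.dist z' z : ℝ) ≤ K := by
    intro i
    by_cases hA : (A i).Nonempty
    · obtain ⟨a, ha⟩ := hA
      obtain ⟨g, rfl⟩ := GeodesicTo.exists_start_eq hc e a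
      obtain ⟨z, hz⟩ := (isEntry_start hc ha).exists_isExit
      exact ⟨z, fun _ => hz.1.2, fun g' z' hz' => h1 i g' g z' z hz' hz⟩
    · exact ⟨e, fun h => absurd h hA, fun g z' hz' => absurd ⟨z', hz'.1.2⟩ hA⟩
  choose b hb using hex
  have hnear : ∀ (i : I) (g g' : GeodesicTo G e),
      (4 * G.dist g.start g'.start ≤ distTo G g.start (A i) ∨ G.dist g.start g'.start ≤ 1) →
      (G.dist g.start g'.start : ℝ) ≤ max ((distTo G g.start (A i) : ℝ) / 4) 1 := by
    rintro i g g' (h | h)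
    · refine le_max_of_le_left ?_
      have : (4 * G.dist g.start g'.start : ℝ) ≤ distTo G g.start (A i) := by exact_mod_cast h
      linarith
    · exact le_max_of_le_right (by exact_mod_cast h)
  refine ⟨b, hc, ?_, ?_, ?_, fun i => (hb i).1, ?_, ?_, fun x => (h3.1 x).1, ?_⟩
  · exact Nat.le_floor (by simpa using hK1)
  · exact fun i g z hz => Nat.le_floor ((hb i).2 g z hz)
  · exact fun i g g' z z' hz hz' => Nat.le_floor (h1 i g g' z z' hz hz')
  · exact fun i g g' h a a' ha ha' => Nat.le_floor ((h2 i g g' (hnear i g g' h)).1 a a' ha ha')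
  · intro i g g' h ht z a hz ha
    refine Nat.le_floor ?_
    push_cast
    exact (h2 i g g' (hnear i g g' h)).2 ht z a hz ha
  · exact fun x F hF => Nat.le_floor (card_le x F hF)

variable {A : I → Set X} {K : ℕ} {b : I → X}

/-- Close points: geodesics from them to `e` behave in the same way at `A i`, up to bounded
error. -/
def Near (G : SimpleGraph X) (A : Set X) (x y : X) : Prop :=
  4 * G.dist x y ≤ distTo G x A ∨ G.dist x y ≤ 1

lemma near_of_le {A : Set X} {x y : X} (h : 5 * G.dist x y ≤ distTo G x A) : Near G A x y :=
  Or.inl (by omega)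

/-- Passing from x to y costs one d(x, y) out of five and leaves four: the factor 5 makes (C2)
usable in both directions. -/
lemma near_of_le' (hc : G.Connected) {A : Set X} {x y : X}
    (h : 5 * G.dist x y ≤ distTo G x A) : Near G A y x := by
  have := distTo_le_add hc A x y
  refine Or.inl ?_
  rw [G.dist_comm (u := y)]
  omega

namespace PieceBounds

variable (hP : PieceBounds G A e K b)
include hP

lemma dist_exit {i : I} {g : GeodesicTo G e} {z : X} (hz : IsExit g (A i) z) :
    G.dist e z ≤ G.dist e (b i) + K ∧ G.dist e (b i) ≤ G.dist e z + K := by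
  have h1 := hP.exit_near i g z hz
  have h2 := hP.connected.dist_triangle (u := e) (v := z) (w := b i)
  have h3 := hP.connected.dist_triangle (u := e) (v := b i) (w := z)
  rw [G.dist_comm (u := b i) (v := z)] at h3
  omega

lemma dist_base_le {i : I} {g : GeodesicTo G e} {z : X} (hz : IsExit g (A i) z) (a : X) :
    G.dist (b i) a ≤ G.dist z a + K ∧ G.dist z a ≤ G.dist (b i) a + K := by
  have h1 := hP.exit_near i g z hz
  have h2 := hP.connected.dist_triangle (u := b i) (v := z) (w := a)
  have h3 := hP.connected.dist_triangle (u := z) (v := b i) (w := a)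
  rw [G.dist_comm (u := b i) (v := z)] at h2
  omega

/-- (C2) lets g' miss the piece only if the segment of g is short, but an entry at distance 2K from
the base point is at distance at least K from the exit. -/
lemma exists_entry_near {i : I} {g g' : GeodesicTo G e} (h : Near G (A i) g.start g'.start)
    {a : X} (ha : IsEntry g (A i) a) (hl : 2 * K ≤ G.dist (b i) a) :
    ∃ a', IsEntry g' (A i) a' ∧ G.dist a a' ≤ K := by
  obtain ⟨z, hz⟩ := ha.exists_isExit
  have h1 := (hP.dist_base_le hz a).1
  have ht : trace g' (A i) ≠ ∅ := fun ht => by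
    have := hP.length_le i g g' h ht z a hz ha
    omega
  obtain ⟨a', ha'⟩ := exists_isEntry g' ht
  exact ⟨a', ha', hP.entry_near i g g' h a a' ha ha'⟩

omit hP in
lemma exists_dist_pred (hc : G.Connected) {x y : X} {s : ℕ} (h : G.dist x y = s + 1) :
    ∃ y', G.dist x y' = s ∧ G.dist y y' = 1 := by
  obtain ⟨g, rfl⟩ := GeodesicTo.exists_start_eq hc x y
  obtain ⟨v, hv, h1⟩ := g.exists_mem_dist_eq hc (t := s) (by omega)
  have := g.dist_start_add hc hv
  exact ⟨v, h1, by omega⟩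

/-- Walk from x ∈ `A i` to y one edge at a time. By (C2) the entry point moves by at most K per edge
until some geodesic misses the piece; at that moment the segment is short, so the entry is near the
base point, and from then on the distance to the base point is tracked instead. -/
lemma entry_or_base_near {i : I} {x : X} (hx : x ∈ A i) (s : ℕ) : ∀ y, G.dist x y = s →
    (∀ g : GeodesicTo G e, g.start = y → ∃ a, IsEntry g (A i) a ∧ G.dist y a ≤ (K + 1) * s) ∨
      G.dist y (b i) ≤ (K + 1) * s + 2 * K := by
  have hc := hP.connected
  induction s with
  | zero =>
    intro y hy
    rw [hc.dist_eq_zero_iff] at hy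
    subst hy
    refine Or.inl fun g hg => ⟨x, ?_, by simp⟩
    subst hg
    exact isEntry_start hc hx
  | succ s ih =>
    intro y hy
    obtain ⟨y', hy', h1⟩ := exists_dist_pred hc hy
    have hmul : (K + 1) * (s + 1) = (K + 1) * s + K + 1 := by ring
    rw [hmul]
    rcases ih y' hy' with h | h
    · obtain ⟨g', rfl⟩ := GeodesicTo.exists_start_eq hc e y'
      obtain ⟨a', ha', hd⟩ := h g' rfl
      have h2 := hc.dist_triangle (u := y) (v := g'.start) (w := a')
      by_cases hm : ∀ g : GeodesicTo G e, g.start = y → trace g (A i) ≠ ∅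
      · refine Or.inl fun g hg => ?_
        obtain ⟨a, ha⟩ := exists_isEntry g (hm g hg)
        refine ⟨a, ha, ?_⟩
        have h3 := hP.entry_near i g g' (Or.inr (by rw [hg, h1])) a a' ha ha'
        have h4 := hc.dist_triangle (u := y) (v := a') (w := a)
        rw [G.dist_comm (u := a')] at h4
        omega
      · push Not at hm
        obtain ⟨g, hg, ht⟩ := hm
        obtain ⟨z, hz⟩ := ha'.exists_isExit
        have h3 := hP.length_le i g' g (Or.inr (by rw [hg, G.dist_comm, h1])) ht z a' hz ha'
        have h4 := (hP.dist_base_le hz a').1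
        have h5 := hc.dist_triangle (u := y) (v := a') (w := b i)
        rw [G.dist_comm (u := a')] at h5
        right
        omega
    · right
      have h2 := hc.dist_triangle (u := y) (v := y') (w := b i)
      omega

/-- A geodesic to `e` enters a piece not much later than it could. -/
lemma dist_entry_le {i : I} {g : GeodesicTo G e} {a : X} (ha : IsEntry g (A i) a) :
    G.dist g.start a ≤ 4 * K * (distTo G g.start (A i) + 1) := by
  have hc := hP.connected
  have hK := hP.one_le
  obtain ⟨x, hx, hd⟩ := exists_dist_eq_distTo G g.start ⟨a, ha.1.2⟩
  rw [G.dist_comm] at hd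
  have key : (K + 1) * distTo G g.start (A i) + 3 * K ≤
      4 * K * (distTo G g.start (A i) + 1) := by nlinarith
  rcases hP.entry_or_base_near hx _ _ hd with h | h
  · obtain ⟨a', ha', h'⟩ := h g rfl
    rw [ha.unique hc ha']
    omega
  · obtain ⟨z, hz⟩ := ha.exists_isExit
    have h1 := ha.dist_start_add hc
    have h2 := (hP.dist_exit hz).2
    have h3 := hz.2 a ha.1
    have h4 := hc.dist_triangle (u := e) (v := b i) (w := g.start)
    rw [G.dist_comm (u := b i)] at h4
    omega

/-- The trace of a geodesic on a piece is coarsely dense between exit and entry. -/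
lemma exists_mem_trace {i : I} {g : GeodesicTo G e} {a z : X} (ha : IsEntry g (A i) a)
    (hz : IsExit g (A i) z) {t : ℕ} (h1 : G.dist e z ≤ t) (h2 : t ≤ G.dist e a) :
    ∃ v ∈ trace g (A i), t ≤ G.dist e v ∧ G.dist e v ≤ t + K := by
  have hc := hP.connected
  obtain ⟨v, ⟨hv, hvt⟩, hmin⟩ := Set.exists_min_image {v | v ∈ trace g (A i) ∧ t ≤ G.dist e v}
    (G.dist e) ((trace_finite g (A i)).subset fun _ h => h.1) ⟨a, ha.1, h2⟩
  refine ⟨v, hv, hvt, ?_⟩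
  -- The vertex v is the lowest one of the trace at level at least t. Compare the tail of g from v,
  -- which enters at v, with the tail starting one vertex later: the latter enters below level t by
  -- minimality, yet within K of v by (C2).
  by_contra hlt
  obtain ⟨g₁, hs₁, hg₁⟩ := g.exists_tail hc hv.1
  have hlev : G.dist e v - 1 ≤ G.dist e g.start := by
    have := g.dist_le_start hc hv.1
    omega
  obtain ⟨v', hv', hd'⟩ := g.exists_mem_dist_eq hc hlev
  obtain ⟨g₂, hs₂, hg₂⟩ := g.exists_tail hc hv'
  have hvv := g.dist_add hc hv.1 hv' (by omega)
  have hz₂ : z ∈ trace g₂ (A i) := ⟨(hg₂ z).2 ⟨hz.1.1, by omega⟩, hz.1.2⟩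
  obtain ⟨a₂, ha₂⟩ := exists_isEntry g₂ (Set.nonempty_iff_ne_empty.1 ⟨z, hz₂⟩)
  have hv₁ : IsEntry g₁ (A i) g₁.start := isEntry_start hc (hs₁ ▸ hv.2)
  rw [hs₁] at hv₁
  have hle := hP.entry_near i g₁ g₂ (Or.inr (by rw [hs₁, hs₂]; omega)) v a₂ hv₁ ha₂
  have ha₂' := (hg₂ a₂).1 ha₂.1.1
  have hlow : G.dist e a₂ < t := by
    by_contra hge
    have := hmin a₂ ⟨⟨ha₂'.1, ha₂.1.2⟩, by omega⟩
    omega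
  have := hc.dist_triangle (u := e) (v := a₂) (w := v)
  rw [G.dist_comm (u := a₂)] at this
  omega

/-- Pieces met by a geodesic in a long segment are met by geodesics from points not too far. -/
lemma exists_entry_of_long {i : I} (k : ℕ) : ∀ {g g' : GeodesicTo G e},
    G.dist g.start g'.start = k → ∀ {a z : X}, IsEntry g (A i) a → IsExit g (A i) z →
    2 * K * k + K ≤ G.dist z a →
    ∃ a' z', IsEntry g' (A i) a' ∧ IsExit g' (A i) z' ∧ G.dist a a' ≤ K * k + K ∧
      G.dist z a ≤ G.dist z' a' + 2 * K * k + 2 * K := by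
  have hc := hP.connected
  induction k with
  | zero =>
    intro g g' hd a z ha hz hl
    -- Equal starting points do not make the geodesics equal, so (C2) is needed even for k = 0;
    -- hence the additive constants.
    have hn : G.dist g.start g'.start ≤ 1 := by omega
    have ht : trace g' (A i) ≠ ∅ := fun ht => by
      have := hP.length_le i g g' (Or.inr hn) ht z a hz ha
      omega
    obtain ⟨a', ha'⟩ := exists_isEntry g' ht
    obtain ⟨z', hz'⟩ := ha'.exists_isExit
    have h1 := hP.entry_near i g g' (Or.inr hn) a a' ha ha'
    have h2 := hP.exit_exit i g g' z z' hz hz'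
    have h3 := hc.dist_triangle (u := z) (v := z') (w := a)
    have h4 := hc.dist_triangle (u := z') (v := a') (w := a)
    rw [G.dist_comm (u := a')] at h4
    exact ⟨a', z', ha', hz', by omega, by omega⟩
  | succ k ih =>
    intro g g' hd a z ha hz hl
    have hmul : 2 * K * (k + 1) = 2 * K * k + 2 * K := by ring
    have hmul' : K * (k + 1) = K * k + K := by ring
    rw [G.dist_comm] at hd
    -- Move one vertex towards the start of g': entry and exit shift by at most K each, so the
    -- segment loses at most 2K.
    obtain ⟨y, hy, hy1⟩ := exists_dist_pred hc hd
    obtain ⟨g₁, rfl⟩ := GeodesicTo.exists_start_eq hc e y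
    have hn : G.dist g.start g₁.start ≤ 1 := by omega
    have ht : trace g₁ (A i) ≠ ∅ := fun ht => by
      have := hP.length_le i g g₁ (Or.inr hn) ht z a hz ha
      omega
    obtain ⟨a₁, ha₁⟩ := exists_isEntry g₁ ht
    obtain ⟨z₁, hz₁⟩ := ha₁.exists_isExit
    have h1 := hP.entry_near i g g₁ (Or.inr hn) a a₁ ha ha₁
    have h2 := hP.exit_exit i g g₁ z z₁ hz hz₁
    have h3 := hc.dist_triangle (u := z) (v := z₁) (w := a)
    have h4 := hc.dist_triangle (u := z₁) (v := a₁) (w := a)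
    rw [G.dist_comm (u := a₁)] at h4
    rw [G.dist_comm] at hy
    obtain ⟨a', z', ha', hz', h5, h6⟩ := ih hy ha₁ hz₁ (by omega)
    have h7 := hc.dist_triangle (u := a) (v := a₁) (w := a')
    exact ⟨a', z', ha', hz', by omega, by omega⟩

end PieceBounds

end SPQR

/-! ### Slowly decaying weights and summability of increments -/

section Decay

/-- Functions that decrease, but at most quadratically fast. -/
structure IsDecay (q : ℕ → ℝ) : Prop where
  nonneg : ∀ n, 0 ≤ q n
  anti : ∀ n, 1 ≤ n → q (n + 1) ≤ q n
  mono : ∀ n : ℕ, 1 ≤ n → (n : ℝ) ^ 2 * q n ≤ ((n : ℝ) + 1) ^ 2 * q (n + 1)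

namespace IsDecay

variable {q : ℕ → ℝ} (hq : IsDecay q)
include hq

lemma antitone {m n : ℕ} (hm : 1 ≤ m) (h : m ≤ n) : q n ≤ q m := by
  induction n, h using Nat.le_induction with
  | base => exact le_rfl
  | succ n hn ih => exact (hq.anti n (hm.trans hn)).trans ih

lemma monotone {m n : ℕ} (hm : 1 ≤ m) (h : m ≤ n) :
    (m : ℝ) ^ 2 * q m ≤ (n : ℝ) ^ 2 * q n := by
  induction n, h using Nat.le_induction with
  | base => exact le_rfl
  | succ n hn ih => exact ih.trans (by exact_mod_cast hq.mono n (hm.trans hn))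

lemma le_of_le_mul {u N c : ℕ} (hN : 1 ≤ N) (hc : 1 ≤ c) (h : u + 1 ≤ c * N) :
    q N ≤ (c : ℝ) ^ 2 * q (u + 1) := by
  have hc' : (1 : ℝ) ≤ c := by exact_mod_cast hc
  have hq0 := hq.nonneg (u + 1)
  rcases le_total (u + 1) N with h' | h'
  · refine (hq.antitone (by omega) h').trans ?_
    nlinarith [mul_nonneg (show (0 : ℝ) ≤ (c : ℝ) ^ 2 - 1 by nlinarith) hq0]
  · have h1 := hq.monotone hN h'
    have hN' : (0 : ℝ) < (N : ℝ) ^ 2 := by positivity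
    have h2 : ((u + 1 : ℕ) : ℝ) ≤ c * N := by exact_mod_cast h
    have h3 : ((u + 1 : ℕ) : ℝ) ^ 2 ≤ (c * N : ℝ) ^ 2 := by gcongr
    have h4 : (N : ℝ) ^ 2 * q N ≤ (N : ℝ) ^ 2 * ((c : ℝ) ^ 2 * q (u + 1)) := by
      calc _ ≤ _ := h1
        _ ≤ (c * N : ℝ) ^ 2 * q (u + 1) := by gcongr
        _ = _ := by ring
    exact le_of_mul_le_mul_left h4 hN'

/-- Product rule: the change of s costs 2 q(N), and the change of q costs at most N' |q(N) - q(N')|,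
which is O(q(N)) since q decreases while n² q(n) increases. -/
lemma abs_mul_sub_mul_le {N N' s s' : ℕ} (hN : 1 ≤ N) (hN' : 1 ≤ N') (h1 : N ≤ N' + 1)
    (h2 : N' ≤ N + 1) (h3 : s ≤ s' + 2) (h4 : s' ≤ s + 2) (h5 : s' ≤ N') :
    |q N * s - q N' * s'| ≤ 10 * q N := by
  have e1 : |(s : ℝ) - s'| ≤ 2 := by
    have h3' : (s : ℝ) ≤ s' + 2 := by exact_mod_cast h3
    have h4' : (s' : ℝ) ≤ s + 2 := by exact_mod_cast h4
    rw [abs_le]; constructor <;> linarith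
  have hq0 := hq.nonneg N
  have hq0' := hq.nonneg N'
  have h5' : (s' : ℝ) ≤ N' := by exact_mod_cast h5
  have hs0 : (0 : ℝ) ≤ s' := by positivity
  have e2 : |q N - q N'| * s' ≤ 8 * q N := by
    refine (mul_le_mul_of_nonneg_left h5' (abs_nonneg _)).trans ?_
    rcases (by omega : N' = N ∨ N' = N + 1 ∨ N = N' + 1) with rfl | rfl | rfl
    · simp; positivity
    · have ha := hq.anti N hN
      have hm := hq.mono N hN
      rw [abs_of_nonneg (by linarith)]
      push_cast at *
      have hn : (1 : ℝ) ≤ N := by exact_mod_cast hN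
      have : ((N : ℝ) + 1) * ((q N - q (N + 1)) * (N + 1)) ≤ (N + 1) * (2 * q N) := by nlinarith
      have := le_of_mul_le_mul_left this (by positivity)
      linarith
    · have ha := hq.anti N' hN'
      have hm := hq.mono N' hN'
      rw [abs_of_nonpos (by linarith)]
      push_cast at *
      have hn : (1 : ℝ) ≤ N' := by exact_mod_cast hN'
      have h6 : ((N' : ℝ)) ^ 2 * q N' ≤ (N' : ℝ) ^ 2 * (4 * q (N' + 1)) := by
        refine hm.trans ?_
        have : ((N' : ℝ) + 1) ^ 2 ≤ (N' : ℝ) ^ 2 * 4 := by nlinarith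
        nlinarith
      have h7 := le_of_mul_le_mul_left h6 (by positivity)
      have h8 : (N' : ℝ) * (-(q (N' + 1) - q N') * N') ≤ N' * (2 * q N') := by
        nlinarith
      have := le_of_mul_le_mul_left h8 (by positivity)
      linarith
  calc |q N * s - q N' * s'| = |q N * (s - s') + (q N - q N') * s'| := by ring_nf
    _ ≤ |q N * (s - s')| + |(q N - q N') * s'| := abs_add_le _ _
    _ = q N * |(s : ℝ) - s'| + |q N - q N'| * s' := by
      rw [abs_mul, abs_mul, abs_of_nonneg hq0, abs_of_nonneg hs0]
    _ ≤ q N * 2 + 8 * q N := by gcongr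
    _ = 10 * q N := by ring

end IsDecay

lemma isDecay_inv : IsDecay fun n : ℕ => (n : ℝ)⁻¹ where
  nonneg n := by positivity
  anti n hn := by
    have : (0 : ℝ) < n := by exact_mod_cast hn
    gcongr
    simp
  mono n hn := by
    have : (0 : ℝ) < n := by exact_mod_cast hn
    push_cast
    field_simp
    linarith

lemma sum_le_of_fiber {J : Type*} (F : Finset J) (u : J → ℕ) {r : ℕ → ℝ} (hr : ∀ n, 0 ≤ r n)
    (hs : Summable r) {h : J → ℝ} (hh : ∀ j ∈ F, h j ≤ r (u j)) (c : ℕ)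
    (hc : ∀ n, ∀ F' ⊆ F, (∀ j ∈ F', u j = n) → F'.card ≤ c) :
    ∑ j ∈ F, h j ≤ c * ∑' n, r n := by
  classical
  calc ∑ j ∈ F, h j ≤ ∑ j ∈ F, r (u j) := Finset.sum_le_sum hh
    _ = ∑ n ∈ F.image u, (F.filter fun j => u j = n).card • r n := Finset.sum_comp _ _
    _ ≤ ∑ n ∈ F.image u, (c : ℝ) * r n := by
      refine Finset.sum_le_sum fun n _ => ?_
      rw [nsmul_eq_mul]
      have : (F.filter fun j => u j = n).card ≤ c :=
        hc n _ (Finset.filter_subset _ _) (by simp)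
      have : ((F.filter fun j => u j = n).card : ℝ) ≤ c := by exact_mod_cast this
      exact mul_le_mul_of_nonneg_right this (hr n)
    _ = c * ∑ n ∈ F.image u, r n := by rw [Finset.mul_sum]
    _ ≤ c * ∑' n, r n := by
      gcongr
      exact hs.sum_le_tsum _ fun n _ => hr n

/-- Uniform `p`-summability of the increments of a family of coordinates `q (N x j) * s x j`. -/
lemma sum_abs_sub_rpow_le {X J : Type*} {q : ℕ → ℝ} (hq : IsDecay q) {p : ℝ} (hp : 0 < p)
    (hs : Summable fun n => q (n + 1) ^ p) (N s : X → J → ℕ) (u : X → J → ℕ) (c₁ c₂ : ℕ)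
    (hc₂ : 1 ≤ c₂) (hN : ∀ x j, 1 ≤ N x j) (hsN : ∀ x j, s x j ≤ N x j)
    (hu : ∀ x j, 0 < s x j → u x j + 1 ≤ c₂ * N x j)
    (hcard : ∀ x n, ∀ F : Finset J, (∀ j ∈ F, 0 < s x j ∧ u x j = n) → F.card ≤ c₁)
    (x y : X) (hxy : ∀ j, N x j ≤ N y j + 1) (hyx : ∀ j, N y j ≤ N x j + 1)
    (hsxy : ∀ j, s x j ≤ s y j + 2) (hsyx : ∀ j, s y j ≤ s x j + 2) (F : Finset J) :
    ∑ j ∈ F, |q (N x j) * s x j - q (N y j) * s y j| ^ p ≤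
      2 * (c₁ * ∑' n, (10 * (c₂ : ℝ) ^ 2) ^ p * q (n + 1) ^ p) := by
  classical
  set D : J → ℝ := fun j => |q (N x j) * s x j - q (N y j) * s y j| ^ p
  have hD0 : ∀ j, 0 ≤ D j := fun j => Real.rpow_nonneg (abs_nonneg _) _
  have hr0 : ∀ n, 0 ≤ (10 * (c₂ : ℝ) ^ 2) ^ p * q (n + 1) ^ p := fun n =>
    mul_nonneg (by positivity) (Real.rpow_nonneg (hq.nonneg _) _)
  have key : ∀ z j, 0 < s z j → |q (N x j) * s x j - q (N y j) * s y j| ≤ 10 * q (N z j) →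
      D j ≤ (10 * (c₂ : ℝ) ^ 2) ^ p * q (u z j + 1) ^ p := by
    intro z j hpos h
    rw [← Real.mul_rpow (by positivity) (hq.nonneg _)]
    refine Real.rpow_le_rpow (abs_nonneg _) (h.trans ?_) hp.le
    have := hq.le_of_le_mul (hN z j) hc₂ (hu z j hpos)
    linarith
  have part : ∀ z, (∀ j, |q (N x j) * s x j - q (N y j) * s y j| ≤ 10 * q (N z j)) →
      ∑ j ∈ F.filter (fun j => 0 < s z j), D j ≤
        c₁ * ∑' n, (10 * (c₂ : ℝ) ^ 2) ^ p * q (n + 1) ^ p := by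
    intro z hz
    refine sum_le_of_fiber _ (u z) hr0 (hs.mul_left _)
      (fun j hj => key z j (Finset.mem_filter.1 hj).2 (hz j)) c₁ fun n F' hF' hn => ?_
    exact hcard z n F' fun j hj => ⟨(Finset.mem_filter.1 (hF' hj)).2, hn j hj⟩
  have hx := part x fun j => hq.abs_mul_sub_mul_le (hN x j) (hN y j) (hxy j) (hyx j) (hsxy j)
    (hsyx j) (hsN y j)
  have hy := part y fun j => by
    rw [abs_sub_comm]
    exact hq.abs_mul_sub_mul_le (hN y j) (hN x j) (hyx j) (hxy j) (hsyx j) (hsxy j) (hsN x j)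
  -- A coordinate inactive at both points contributes nothing; the others are charged to a point
  -- where they are active.
  have hsplit : ∑ j ∈ F, D j ≤ ∑ j ∈ F.filter (fun j => 0 < s x j), D j +
      ∑ j ∈ F.filter (fun j => 0 < s y j), D j := by
    rw [Finset.sum_filter, Finset.sum_filter, ← Finset.sum_add_distrib]
    refine Finset.sum_le_sum fun j _ => ?_
    by_cases h1 : 0 < s x j
    · rw [if_pos h1]
      split_ifs
      · linarith [hD0 j]
      · linarith
    · by_cases h2 : 0 < s y j
      · rw [if_neg h1, if_pos h2, zero_add]
      · have h1' : s x j = 0 := by omega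
        have h2' : s y j = 0 := by omega
        simp [D, h1', h2', Real.zero_rpow hp.ne']
  linarith

end Decay

/-! ### From coordinates to a Lipschitz map into ℓ^p -/

section LpMap

variable {X : Type u} {G : SimpleGraph X}

/-- A family of coordinates whose increments along edges are uniformly `p`-summable defines, up to
a constant, a Lipschitz map into `ℓ^p`. -/
lemma exists_lp_map (hc : G.Connected) {Z : Type*} {p : ℝ} (hp : 1 < p) (Φ : X → Z → ℝ) {C : ℝ}
    (hC0 : 0 ≤ C)
    (hC : ∀ x y, G.Adj x y → ∀ F : Finset Z, ∑ z ∈ F, |Φ x z - Φ y z| ^ p ≤ C) :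
    ∃ φ : X → lp (fun _ : Z => ℝ) (ENNReal.ofReal p),
      (∀ x y z, (φ x - φ y) z = Φ x z - Φ y z) ∧
      ∀ x y, ‖φ x - φ y‖ ≤ C ^ (1 / p) * G.dist x y := by
  have hp0 : 0 < p := by linarith
  have hpr : (ENNReal.ofReal p).toReal = p := ENNReal.toReal_ofReal hp0.le
  have : Fact (1 ≤ ENNReal.ofReal p) := ⟨by simpa using ENNReal.ofReal_le_ofReal hp.le⟩
  obtain ⟨o⟩ := hc.nonempty
  have hadj : ∀ x y, G.Adj x y → Memℓp (fun z => Φ x z - Φ y z) (ENNReal.ofReal p) := by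
    intro x y h
    refine memℓp_gen' (C := C) fun s => ?_
    simpa [hpr, Real.norm_eq_abs] using hC x y h s
  -- No Φ x need be p-summable: differences are, by adding up along a walk, so Φ x - Φ o is used for
  -- a fixed vertex o.
  have hwalk : ∀ x y, G.Walk x y → Memℓp (fun z => Φ x z - Φ y z) (ENNReal.ofReal p) := by
    intro x y w
    induction w with
    | nil =>
      convert zero_memℓp (p := ENNReal.ofReal p) (E := fun _ : Z => ℝ) using 1
      ext z
      simp
    | cons h w ih =>
      convert (hadj _ _ h).add ih using 1
      ext z
      simp
  have hmem : ∀ x, Memℓp (fun z => Φ x z - Φ o z) (ENNReal.ofReal p) :=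
    fun x => hwalk x o (hc x o).some
  let φ : X → lp (fun _ : Z => ℝ) (ENNReal.ofReal p) := fun x => ⟨fun z => Φ x z - Φ o z, hmem x⟩
  have hφ : ∀ x y z, (φ x - φ y) z = Φ x z - Φ y z := by
    intro x y z
    change (Φ x z - Φ o z) - (Φ y z - Φ o z) = _
    ring
  refine ⟨φ, hφ, fun x y => ?_⟩
  have hstep : ∀ x y, G.Adj x y → ‖φ x - φ y‖ ≤ C ^ (1 / p) := by
    intro x y h
    refine lp.norm_le_of_forall_sum_le (by rw [hpr]; exact hp0) (by positivity) fun s => ?_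
    rw [hpr, ← Real.rpow_mul hC0, one_div_mul_cancel hp0.ne', Real.rpow_one]
    simpa [hφ, Real.norm_eq_abs] using hC x y h s
  have hlen : ∀ x y (w : G.Walk x y), ‖φ x - φ y‖ ≤ C ^ (1 / p) * w.length := by
    intro x y w
    induction w with
    | nil => simp
    | cons h w ih =>
      refine (norm_sub_le_norm_sub_add_norm_sub _ (φ _) _).trans
        ((add_le_add (hstep _ _ h) ih).trans ?_)
      rw [SimpleGraph.Walk.length_cons]
      push_cast
      linarith
  obtain ⟨w, hw⟩ := hc.exists_walk_length_eq_dist x y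
  rw [← hw]
  exact hlen x y w

end LpMap

/-! ### Counting radii in a window: the level coordinates -/

namespace SPQR

variable {X : Type u} {I : Type v} {G : SimpleGraph X} {e : X}

/-- The size of the window around `x` used for a piece `A`. -/
noncomputable def window (G : SimpleGraph X) (W : ℕ) (A : Set X) (x : X) : ℕ :=
  distTo G x A / W + 1

/-- The number of radii `k` below the window such that the `k`-ball around `x` meets `S` but
not `B`. -/
noncomputable def radiusCount (G : SimpleGraph X) (W : ℕ) (A S B : Set X) (x : X) : ℕ :=
  truncDist G (window G W A x) x B - truncDist G (window G W A x) x S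

lemma one_le_window (W : ℕ) (A : Set X) (x : X) : 1 ≤ window G W A x := Nat.le_add_left _ _

lemma window_le_add (hc : G.Connected) (W : ℕ) (hW : 0 < W) (A : Set X) {x y : X}
    (h : G.dist x y ≤ 1) : window G W A x ≤ window G W A y + 1 := by
  have := distTo_le_add hc A x y
  have h1 : distTo G x A / W ≤ (distTo G y A + W) / W := Nat.div_le_div_right (by omega)
  rw [Nat.add_div_right _ hW] at h1
  unfold window
  omega

lemma radiusCount_le (W : ℕ) (A S B : Set X) (x : X) :
    radiusCount G W A S B x ≤ window G W A x :=
  (Nat.sub_le _ _).trans (truncDist_le _ _ _ _)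

/-- Along an edge the distance to a set and the truncation level both move by at most 1, hence so
does each of the two truncated distances. -/
lemma radiusCount_le_add (hc : G.Connected) (W : ℕ) (hW : 0 < W) (A S B : Set X) {x y : X}
    (h : G.dist x y ≤ 1) : radiusCount G W A S B x ≤ radiusCount G W A S B y + 2 := by
  have h1 := window_le_add hc W hW A h
  have h' : G.dist y x ≤ 1 := by rwa [G.dist_comm]
  have h2 := window_le_add hc W hW A h'
  have h3 := truncDist_le_add hc _ _ 1 x y B h1 h
  have h4 := truncDist_le_add hc _ _ 1 y x S h2 h'
  unfold radiusCount
  omega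

lemma exists_of_truncDist_lt_window {W : ℕ} (hW : 0 < W) {A S : Set X} {x : X}
    (h : truncDist G (window G W A x) x S < window G W A x) :
    ∃ y ∈ S, G.dist x y = truncDist G (window G W A x) x S ∧ W * G.dist x y ≤ distTo G x A := by
  obtain ⟨y, hy, h1⟩ := exists_dist_eq_truncDist h
  refine ⟨y, hy, h1, ?_⟩
  rw [← h1] at h
  have : G.dist x y ≤ distTo G x A / W := by unfold window at h; omega
  rw [Nat.le_div_iff_mul_le hW] at this
  linarith

lemma exists_of_radiusCount_pos {W : ℕ} (hW : 0 < W) {A S B : Set X} {x : X}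
    (h : 0 < radiusCount G W A S B x) :
    ∃ y ∈ S, W * G.dist x y ≤ distTo G x A ∧ ∀ z ∈ B, G.dist x y < G.dist x z := by
  have h1 := truncDist_le G (window G W A x) x B
  unfold radiusCount at h
  obtain ⟨y, hy, h2, h3⟩ := exists_of_truncDist_lt_window (G := G) (A := A) (S := S) (x := x) hW
    (by omega)
  refine ⟨y, hy, h3, fun z hz => ?_⟩
  have := truncDist_le_dist G (window G W A x) x hz
  omega

/-- Starting points of geodesics entering the piece `A i` for a long time, in such a way that
the level `t` lies in the corresponding segment, and not much deeper than its entry point. -/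
def longSet (G : SimpleGraph X) (A : I → Set X) (e : X) (K : ℕ) (b : I → X) (i : I) (t : ℕ) :
    Set X :=
  {y | ∃ g : GeodesicTo G e, g.start = y ∧ ∃ c, IsEntry g (A i) c ∧ 2 * K ≤ G.dist (b i) c ∧
    G.dist e (b i) ≤ t + K ∧ t ≤ G.dist e c ∧ 2 * G.dist e c ≤ G.dist e y + t}

/-- Starting points of geodesics entering the piece `A i` at level `t`. -/
def entrySet (G : SimpleGraph X) (A : I → Set X) (e : X) (K : ℝ) (i : I) (t : ℕ) : Set X :=
  {y | 5 * K ≤ t ∧ ∃ g : GeodesicTo G e, g.start = y ∧ ∃ a, IsEntry g (A i) a ∧ G.dist e a = t}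

/-- Starting points of geodesics for which the level `t` is in the middle of a long segment in some
piece. -/
def forbidSet (G : SimpleGraph X) (A : I → Set X) (e : X) (K : ℝ) (t : ℕ) : Set X :=
  {y | ∃ g : GeodesicTo G e, g.start = y ∧ ∃ (j : I) (z c : X), IsExit g (A j) z ∧
    IsEntry g (A j) c ∧ 5 * K ≤ (G.dist z c : ℝ) + 1 ∧
    (t : ℝ) ∈ Set.Icc ((G.dist e z : ℝ) + 2 * K) ((G.dist e c : ℝ) - 2 * K)}

variable {A : I → Set X} {K : ℕ} {b : I → X}

namespace PieceBounds

variable (hP : PieceBounds G A e K b)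
include hP

/-- Finitely many pieces are met by a given geodesic at given levels. -/
lemma card_le_of_trace {J : Type*} (g : GeodesicTo G e) (f : J → I) (F : Finset J)
    (hf : Set.InjOn f F) (l m : ℕ)
    (h : ∀ j ∈ F, ∃ v ∈ trace g (A (f j)), l ≤ G.dist e v ∧ G.dist e v < l + m) :
    F.card ≤ K * m := by
  classical
  have : Nonempty X := ⟨e⟩
  choose! v hv hl using h
  have := Finset.card_le_mul_card_image_of_maps_to (s := F) (t := Finset.Ico l (l + m))
    (f := fun j => G.dist e (v j)) (fun j hj => Finset.mem_Ico.2 (hl j hj)) K (fun n _ => ?_)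
  · simpa using this
  · rcases (F.filter fun j => G.dist e (v j) = n).eq_empty_or_nonempty with h0 | ⟨j₀, hj₀⟩
    · simp [h0]
    · rw [← Finset.card_image_of_injOn (f := f)
        (hf.mono fun j hj => (Finset.mem_filter.1 hj).1)]
      refine hP.card_le (v j₀) _ fun i hi => ?_
      obtain ⟨j, hj, rfl⟩ := Finset.mem_image.1 hi
      rw [Finset.mem_filter] at hj hj₀
      rw [g.eq_of_dist_eq hP.connected (hv j₀ hj₀.1).1 (hv j hj.1).1 (hj.2.trans hj₀.2.symm)]
      exact (hv j hj.1).2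

/-- An entry far from the base point persists under (C2), so an active coordinate (i, t) forces
every geodesic from x to meet `A i` near level t. It also forces the window to be at least
proportional to the depth of t below x. -/
lemma long_support {W : ℕ} (hW : 5 ≤ W) {i : I} {t : ℕ} {x : X} {B : Set X}
    (h : 0 < radiusCount G W (A i) (longSet G A e K b i t) B x) {g : GeodesicTo G e}
    (hg : g.start = x) :
    (∃ v ∈ trace g (A i), t ≤ G.dist e v + K ∧ G.dist e v ≤ t + 2 * K) ∧
      t ≤ G.dist e x + K ∧
      (G.dist e x + K - t) + 1 ≤ 26 * K * W * window G W (A i) x := by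
  have hc := hP.connected
  have hK := hP.one_le
  obtain ⟨y, ⟨g', rfl, c, hcc, h2, h3, h4, h5⟩, hy, -⟩ :=
    exists_of_radiusCount_pos (by omega) h
  subst hg
  have hWd : 5 * G.dist g.start g'.start ≤ distTo G g.start (A i) :=
    (Nat.mul_le_mul_right _ hW).trans hy
  obtain ⟨c', hc', hcd⟩ := hP.exists_entry_near (near_of_le' hc hWd) hcc h2
  obtain ⟨z', hz'⟩ := hc'.exists_isExit
  have h6 := (hP.dist_exit hz').1
  have h7 := hc.dist_triangle (u := e) (v := c') (w := c)
  rw [G.dist_comm (u := c')] at h7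
  have hv : ∃ v ∈ trace g (A i), t ≤ G.dist e v + K ∧ G.dist e v ≤ t + 2 * K := by
    by_cases hlo : G.dist e z' ≤ t
    · by_cases hhi : t ≤ G.dist e c'
      · obtain ⟨v, hv, h8, h9⟩ := hP.exists_mem_trace hc' hz' hlo hhi
        exact ⟨v, hv, by omega, by omega⟩
      · exact ⟨c', hc'.1, by omega, by omega⟩
    · exact ⟨z', hz'.1, by omega, by omega⟩
  refine ⟨hv, ?_, ?_⟩
  · obtain ⟨v, hv, h8, h9⟩ := hv
    have := g.dist_le_start hc hv.1
    omega
  -- The last condition in `longSet` says |y| - t ≤ 2 d(y, c) for y the start of g', and d(y, c) is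
  -- at most a multiple of d(y, A i) + 1; this in turn is at most twice d(x, A i) + 1.
  · have h8 := hP.dist_entry_le hcc
    have h9 := hcc.dist_start_add hc
    have h10 := distTo_le_add hc (A i) g'.start g.start
    rw [G.dist_comm (u := g'.start)] at h10
    have h11 := hc.dist_triangle (u := e) (v := g'.start) (w := g.start)
    rw [G.dist_comm (u := g'.start) (v := g.start)] at h11
    have h12 : distTo G g.start (A i) + 1 ≤ W * window G W (A i) g.start := by
      have := Nat.div_add_mod (distTo G g.start (A i)) W
      have := Nat.mod_lt (distTo G g.start (A i)) (show W > 0 by omega)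
      unfold window
      rw [mul_add]
      omega
    have h13 : 4 * K * (distTo G g'.start (A i) + 1) ≤
        4 * K * (2 * (distTo G g.start (A i) + 1)) := Nat.mul_le_mul_left _ (by omega)
    have h14 : 26 * K * (distTo G g.start (A i) + 1) ≤ 26 * K * W * window G W (A i) g.start := by
      rw [mul_assoc (26 * K) W]
      exact Nat.mul_le_mul_left _ h12
    have h15 : distTo G g.start (A i) + 1 ≤ K * (distTo G g.start (A i) + 1) :=
      Nat.le_mul_of_pos_left _ hK
    have h16 : K * 1 ≤ K * (distTo G g.start (A i) + 1) := Nat.mul_le_mul_left _ (by omega)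
    have h17 : 4 * K * (2 * (distTo G g.start (A i) + 1)) =
      8 * (K * (distTo G g.start (A i) + 1)) := by ring
    have h18 : 26 * K * (distTo G g.start (A i) + 1) =
      26 * (K * (distTo G g.start (A i) + 1)) := by ring
    omega

/-- The depth n fixes the level t, and each active piece meets one fixed geodesic within 3K + 1
levels around t, with at most K pieces through each vertex. -/
lemma card_long_le {W : ℕ} (hW : 5 ≤ W) (x : X) (n : ℕ) (F : Finset (I × ℕ))
    (h : ∀ j ∈ F, 0 < radiusCount G W (A j.1) (longSet G A e K b j.1 j.2) ∅ x ∧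
      G.dist e x + K - j.2 = n) : F.card ≤ K * (3 * K + 1) := by
  obtain ⟨g, hg⟩ := GeodesicTo.exists_start_eq hP.connected e x
  have ht : ∀ j ∈ F, j.2 = G.dist e x + K - n := fun j hj => by
    have := (hP.long_support hW (h j hj).1 hg).2.1
    have := (h j hj).2
    omega
  refine hP.card_le_of_trace g Prod.fst F (fun j hj j' hj' hjj => ?_)
    (G.dist e x + K - n - K) _ fun j hj => ?_
  · exact Prod.ext hjj ((ht j hj).trans (ht j' hj').symm)
  · obtain ⟨⟨v, hv, h1, h2⟩, -⟩ := hP.long_support hW (h j hj).1 hg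
    have := ht j hj
    exact ⟨v, hv, by omega, by omega⟩

/-- Entries into a given piece from points in a common window have nearby levels. -/
lemma entry_level_le {i : I} {g g₁ g₂ : GeodesicTo G e} {a₁ a₂ : X}
    (h₁ : 5 * G.dist g.start g₁.start ≤ distTo G g.start (A i))
    (h₂ : Near G (A i) g.start g₂.start)
    (ha₁ : IsEntry g₁ (A i) a₁) (ha₂ : IsEntry g₂ (A i) a₂) :
    G.dist e a₁ ≤ G.dist e a₂ + 2 * K := by
  have hc := hP.connected
  -- If g misses the piece, the segment of g₁ is short and its exit is within K of that of g₂;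
  -- otherwise both entries are compared with the entry of g.
  by_cases ht : trace g (A i) = ∅
  · obtain ⟨z₁, hz₁⟩ := ha₁.exists_isExit
    obtain ⟨z₂, hz₂⟩ := ha₂.exists_isExit
    have h3 := hP.length_le i g₁ g (near_of_le' hc h₁) ht z₁ a₁ hz₁ ha₁
    have h4 := ha₁.dist_isExit hc hz₁
    have h5 := hP.exit_exit i g₁ g₂ z₁ z₂ hz₁ hz₂
    have h6 := hz₂.2 _ ha₂.1
    have h7 := hc.dist_triangle (u := e) (v := z₂) (w := z₁)
    rw [G.dist_comm (u := z₂)] at h7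
    omega
  · obtain ⟨a, ha⟩ := exists_isEntry g ht
    have h3 := hP.entry_near i g g₁ (near_of_le h₁) a a₁ ha ha₁
    have h4 := hP.entry_near i g g₂ h₂ a a₂ ha ha₂
    have h5 := hc.dist_triangle (u := e) (v := a₂) (w := a)
    have h6 := hc.dist_triangle (u := e) (v := a) (w := a₁)
    rw [G.dist_comm (u := a₂)] at h5
    omega

variable {K₀ : ℝ}

/-- A positive count gives a radius at which some geodesic from the ball enters at level t while
none from the ball forbids t; the entry point is then in the boundary. Entry levels in the window
drop by at most 2K, so the bound 5K in `entrySet` leaves the required 3K for every boundary point.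
-/
lemma mem_relevant {W : ℕ} (hW : 5 ≤ W) (hK : (K : ℝ) ≤ K₀) {i : I} {t : ℕ} {x : X}
    (h : 0 < radiusCount G W (A i) (entrySet G A e K₀ i t) (forbidSet G A e K₀ t) x) :
    i ∈ relevant G e A K₀ x := by
  have hc := hP.connected
  obtain ⟨y, ⟨h5, g₁, rfl, a₁, ha₁, rfl⟩, hy, hz⟩ := exists_of_radiusCount_pos (by omega) h
  obtain ⟨g, rfl⟩ := GeodesicTo.exists_start_eq hc e x
  have hWd : 5 * G.dist g.start g₁.start ≤ distTo G g.start (A i) :=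
    (Nat.mul_le_mul_right _ hW).trans hy
  constructor
  · refine ⟨a₁, G.dist g.start g₁.start, ?_, ⟨g₁, le_refl (G.dist g.start g₁.start), ha₁⟩, ?_⟩
    · have : (5 * G.dist g.start g₁.start : ℝ) ≤ distTo G g.start (A i) := by exact_mod_cast hWd
      have h0 : (0 : ℝ) ≤ G.dist g.start g₁.start := by positivity
      linarith
    · intro g' hg' j z c hz' hc' hl hmem
      have := hz g'.start ⟨g', rfl, j, z, c, hz', hc', hl, hmem⟩
      have hg'' : G.dist g.start g'.start ≤ G.dist g.start g₁.start := hg'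
      omega
  · rintro a₂ ⟨k, hk, ⟨g₂, hg₂, ha₂⟩, -⟩
    have hn : Near G (A i) g.start g₂.start := by
      left
      have h1 : (G.dist g.start g₂.start : ℝ) ≤ k := by exact_mod_cast hg₂
      have h2 : (4 * G.dist g.start g₂.start : ℝ) ≤ distTo G g.start (A i) := by linarith
      exact_mod_cast h2
    have h6 := hP.entry_level_le hWd hn ha₁ ha₂
    have h7 : (G.dist e a₁ : ℝ) ≤ G.dist e a₂ + 2 * K := by exact_mod_cast h6
    linarith

/-- (C4) bounds the number of pieces, and for each piece the active levels lie in an interval of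
length 2K by `entry_level_le`. -/
lemma card_entry_le {W : ℕ} (hW : 5 ≤ W) (hK : (K : ℝ) ≤ K₀) (hK' : K₀ < K + 1)
    (h4 : C4 G e A K₀) (x : X) (n : ℕ) (F : Finset (I × ℕ))
    (h : ∀ j ∈ F, 0 < radiusCount G W (A j.1) (entrySet G A e K₀ j.1 j.2)
      (forbidSet G A e K₀ j.2) x ∧ distTo G x (A j.1) = n) : F.card ≤ (2 * K + 1) * K := by
  classical
  have hc := hP.connected
  have himg : (F.image Prod.fst).card ≤ K := by
    obtain ⟨hfin, hle⟩ := h4 x n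
    have hsub : ((F.image Prod.fst : Finset I) : Set I) ⊆
        {i | i ∈ relevant G e A K₀ x ∧ distTo G x (A i) = n} := by
      intro i hi
      obtain ⟨j, hj, rfl⟩ := Finset.mem_image.1 (Finset.mem_coe.1 hi)
      exact ⟨hP.mem_relevant hW hK (h j hj).1, (h j hj).2⟩
    have h1 := Set.ncard_le_ncard hsub hfin
    rw [Set.ncard_coe_finset] at h1
    have h2 : ((F.image Prod.fst).card : ℝ) ≤ K₀ := le_trans (by exact_mod_cast h1) hle
    have h3 : ((F.image Prod.fst).card : ℝ) < ((K + 1 : ℕ) : ℝ) := by push_cast; linarith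
    have := Nat.cast_lt.1 h3
    omega
  refine (Finset.card_le_mul_card_image (f := Prod.fst) F (2 * K + 1) fun i _ => ?_).trans
    (Nat.mul_le_mul_left _ himg)
  set F' := F.filter fun j => j.1 = i with hF'
  rcases F'.eq_empty_or_nonempty with h0 | hne
  · simp [h0]
  obtain ⟨j₀, hj₀, hmin⟩ := Finset.exists_min_image F' Prod.snd hne
  have hinj : Set.InjOn Prod.snd (F' : Set (I × ℕ)) := by
    intro j hj j' hj' hjj
    have h1 := (Finset.mem_filter.1 (Finset.mem_coe.1 hj)).2
    have h2 := (Finset.mem_filter.1 (Finset.mem_coe.1 hj')).2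
    exact Prod.ext (h1.trans h2.symm) hjj
  rw [← Finset.card_image_of_injOn hinj]
  have hsub : F'.image Prod.snd ⊆ Finset.Icc j₀.2 (j₀.2 + 2 * K) := by
    intro t ht
    obtain ⟨j, hj, rfl⟩ := Finset.mem_image.1 ht
    refine Finset.mem_Icc.2 ⟨hmin j hj, ?_⟩
    obtain ⟨hjF, hji⟩ := Finset.mem_filter.1 hj
    obtain ⟨hj₀F, hj₀i⟩ := Finset.mem_filter.1 hj₀
    obtain ⟨y, ⟨-, g₁, rfl, a₁, ha₁, hl₁⟩, hy, -⟩ :=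
      exists_of_radiusCount_pos (by omega) (h j hjF).1
    obtain ⟨y, ⟨-, g₂, rfl, a₂, ha₂, hl₂⟩, hy₂, -⟩ :=
      exists_of_radiusCount_pos (by omega) (h j₀ hj₀F).1
    obtain ⟨g, rfl⟩ := GeodesicTo.exists_start_eq hc e x
    rw [hji] at ha₁ hy
    rw [hj₀i] at ha₂ hy₂
    have := hP.entry_level_le ((Nat.mul_le_mul_right _ hW).trans hy)
      (near_of_le ((Nat.mul_le_mul_right _ hW).trans hy₂)) ha₁ ha₂
    omega
  simpa [Nat.add_sub_cancel_left, add_assoc] using Finset.card_le_card hsub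

lemma sum_long_le {W : ℕ} (hW : 5 ≤ W) {q : ℕ → ℝ} (hq : IsDecay q) {p : ℝ} (hp : 0 < p)
    (hs : Summable fun n => q (n + 1) ^ p) :
    ∃ C : ℝ, 0 ≤ C ∧ ∀ x y, G.Adj x y → ∀ F : Finset (I × ℕ),
      ∑ j ∈ F, |q (window G W (A j.1) x) * radiusCount G W (A j.1) (longSet G A e K b j.1 j.2) ∅ x -
        q (window G W (A j.1) y) *
          radiusCount G W (A j.1) (longSet G A e K b j.1 j.2) ∅ y| ^ p ≤ C := by
  have hc := hP.connected
  have hK := hP.one_le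
  have hW0 : 0 < W := by omega
  -- The scale of the coordinate (i, t) is the depth of t below x, shifted by K so that the
  -- subtraction is not truncated for active coordinates.
  refine ⟨_, ?_, fun x y hxy F => sum_abs_sub_rpow_le hq hp hs
    (fun x (j : I × ℕ) => window G W (A j.1) x)
    (fun x j => radiusCount G W (A j.1) (longSet G A e K b j.1 j.2) ∅ x)
    (fun x j => G.dist e x + K - j.2) (K * (3 * K + 1)) (26 * K * W) ?_
    (fun x j => one_le_window _ _ _) (fun x j => radiusCount_le _ _ _ _ _) ?_
    (fun x n F hF => hP.card_long_le hW x n F hF) x y ?_ ?_ ?_ ?_ F⟩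
  · exact mul_nonneg (by norm_num) (mul_nonneg (Nat.cast_nonneg _) (tsum_nonneg fun n =>
      mul_nonneg (by positivity) (Real.rpow_nonneg (hq.nonneg _) _)))
  · exact Nat.mul_pos (Nat.mul_pos (by omega) hK) hW0
  · intro x j h
    obtain ⟨g, hg⟩ := GeodesicTo.exists_start_eq hc e x
    exact (hP.long_support hW h hg).2.2
  all_goals
    have h1 : G.dist x y ≤ 1 := by rw [SimpleGraph.dist_eq_one_iff_adj.2 hxy]
    have h2 : G.dist y x ≤ 1 := by rwa [G.dist_comm]
    intro j
  · exact window_le_add hc W hW0 _ h1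
  · exact window_le_add hc W hW0 _ h2
  · exact radiusCount_le_add hc W hW0 _ _ _ h1
  · exact radiusCount_le_add hc W hW0 _ _ _ h2

lemma sum_entry_le {W : ℕ} (hW : 5 ≤ W) (hK : (K : ℝ) ≤ K₀) (hK' : K₀ < K + 1)
    (h4 : C4 G e A K₀) {q : ℕ → ℝ} (hq : IsDecay q) {p : ℝ} (hp : 0 < p)
    (hs : Summable fun n => q (n + 1) ^ p) :
    ∃ C : ℝ, 0 ≤ C ∧ ∀ x y, G.Adj x y → ∀ F : Finset (I × ℕ),
      ∑ j ∈ F, |q (window G W (A j.1) x) *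
          radiusCount G W (A j.1) (entrySet G A e K₀ j.1 j.2) (forbidSet G A e K₀ j.2) x -
        q (window G W (A j.1) y) * radiusCount G W (A j.1) (entrySet G A e K₀ j.1 j.2)
          (forbidSet G A e K₀ j.2) y| ^ p ≤ C := by
  have hc := hP.connected
  have hW0 : 0 < W := by omega
  -- Here the scale is d(x, A i), the quantity by which (C4) counts.
  refine ⟨_, ?_, fun x y hxy F => sum_abs_sub_rpow_le hq hp hs
    (fun x (j : I × ℕ) => window G W (A j.1) x)
    (fun x j => radiusCount G W (A j.1) (entrySet G A e K₀ j.1 j.2) (forbidSet G A e K₀ j.2) x)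
    (fun x j => distTo G x (A j.1)) ((2 * K + 1) * K) W (by omega)
    (fun x j => one_le_window _ _ _) (fun x j => radiusCount_le _ _ _ _ _) ?_
    (fun x n F hF => hP.card_entry_le hW hK hK' h4 x n F hF) x y ?_ ?_ ?_ ?_ F⟩
  · exact mul_nonneg (by norm_num) (mul_nonneg (Nat.cast_nonneg _) (tsum_nonneg fun n =>
      mul_nonneg (by positivity) (Real.rpow_nonneg (hq.nonneg _) _)))
  · intro x j _
    have := Nat.div_add_mod (distTo G x (A j.1)) W
    have := Nat.mod_lt (distTo G x (A j.1)) hW0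
    simp only [window, mul_add]
    omega
  all_goals
    have h1 : G.dist x y ≤ 1 := by rw [SimpleGraph.dist_eq_one_iff_adj.2 hxy]
    have h2 : G.dist y x ≤ 1 := by rwa [G.dist_comm]
    intro j
  · exact window_le_add hc W hW0 _ h1
  · exact window_le_add hc W hW0 _ h2
  · exact radiusCount_le_add hc W hW0 _ _ _ h1
  · exact radiusCount_le_add hc W hW0 _ _ _ h2

end PieceBounds

end SPQR

/-! ### Weighted averages of vectors -/

section WeightedAverage

variable {X : Type u} {V : Type*} [NormedAddCommGroup V] [NormedSpace ℝ V]

/-- The average of `F` with respect to the weights `m`. -/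
noncomputable def weightedAverage (m : X → ℕ) (F : X → V) : V :=
  (∑ᶠ a, (m a : ℝ))⁻¹ • ∑ᶠ a, (m a : ℝ) • F a

lemma weightedAverage_eq_zero {m : X → ℕ} {F : X → V} (h : ∀ a, 0 < m a → F a = 0) :
    weightedAverage m F = 0 := by
  have : ∀ a, (m a : ℝ) • F a = 0 := fun a => by
    rcases Nat.eq_zero_or_pos (m a) with h0 | h0
    · simp [h0]
    · simp [h a h0]
  simp [weightedAverage, this]

lemma weightedAverage_eq_sum {m : X → ℕ} {F : X → V} {T : Finset X}
    (hT : ∀ a, 0 < m a → a ∈ T) :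
    weightedAverage m F = (∑ a ∈ T, (m a : ℝ))⁻¹ • ∑ a ∈ T, (m a : ℝ) • F a := by
  have h0 : ∀ a, (m a : ℝ) ≠ 0 → a ∈ T := fun a ha =>
    hT a (Nat.pos_of_ne_zero (by exact_mod_cast ha))
  rw [weightedAverage, finsum_eq_sum_of_support_subset (s := T) _ fun a ha => h0 a ha,
    finsum_eq_sum_of_support_subset (s := T) _ fun a ha => h0 a (left_ne_zero_of_smul ha)]

lemma sum_smul_sub_weightedAverage {m : X → ℕ} {F : X → V} {T : Finset X}
    (hT : ∀ a, 0 < m a → a ∈ T) (hpos : ∃ a, 0 < m a) :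
    ∑ a ∈ T, (m a : ℝ) • (F a - weightedAverage m F) = 0 := by
  obtain ⟨a₀, ha₀⟩ := hpos
  have hS : 0 < ∑ a ∈ T, (m a : ℝ) :=
    Finset.sum_pos' (fun a _ => by positivity) ⟨a₀, hT a₀ ha₀, by exact_mod_cast ha₀⟩
  simp only [smul_sub, Finset.sum_sub_distrib, ← Finset.sum_smul]
  rw [weightedAverage_eq_sum hT, smul_smul, mul_inv_cancel₀ hS.ne', one_smul, sub_self]

lemma norm_sub_weightedAverage_le {m : X → ℕ} {F : X → V} {T : Finset X}
    (hT : ∀ a, 0 < m a → a ∈ T) (hpos : ∃ a, 0 < m a) {R : ℝ} (v : V)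
    (hR : ∀ a, 0 < m a → ‖v - F a‖ ≤ R) : ‖v - weightedAverage m F‖ ≤ R := by
  have h0 := sum_smul_sub_weightedAverage (F := F) hT hpos
  obtain ⟨a₀, ha₀⟩ := hpos
  have hS : 0 < ∑ a ∈ T, (m a : ℝ) :=
    Finset.sum_pos' (fun a _ => by positivity) ⟨a₀, hT a₀ ha₀, by exact_mod_cast ha₀⟩
  have h1 : (∑ a ∈ T, (m a : ℝ)) • (v - weightedAverage m F) =
      ∑ a ∈ T, (m a : ℝ) • (v - F a) := by
    rw [Finset.sum_smul, ← sub_eq_zero, ← Finset.sum_sub_distrib, ← h0]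
    refine Finset.sum_congr rfl fun a _ => ?_
    rw [← smul_sub]
    congr 1
    abel
  have h2 : ‖∑ a ∈ T, (m a : ℝ) • (v - F a)‖ ≤ (∑ a ∈ T, (m a : ℝ)) * R := by
    rw [Finset.sum_mul]
    refine norm_sum_le_of_le _ fun a _ => ?_
    rw [norm_smul, Real.norm_of_nonneg (Nat.cast_nonneg _)]
    rcases Nat.eq_zero_or_pos (m a) with h | h
    · simp [h]
    · exact mul_le_mul_of_nonneg_left (hR a h) (Nat.cast_nonneg _)
  rw [← h1, norm_smul, Real.norm_of_nonneg hS.le] at h2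
  exact le_of_mul_le_mul_left h2 hS

/-- Since ∑ m' (F - w') = 0 for the second average w', one has (∑ m)(w - w') = ∑ (m - m')(F - w').
The right side has |T| terms of norm at most 2R, and ∑ m ≥ N. -/
lemma norm_weightedAverage_sub_le {m m' : X → ℕ} {F : X → V} {T : Finset X}
    (hT : ∀ a, 0 < m a → a ∈ T) (hT' : ∀ a, 0 < m' a → a ∈ T) {N : ℕ} (hN : 0 < N)
    (hpos : ∃ a, N ≤ m a) (hpos' : ∃ a, 0 < m' a) {R : ℝ}
    (hR : ∀ a ∈ T, ∀ a' ∈ T, ‖F a - F a'‖ ≤ R) (hm : ∀ a, m a ≤ m' a + 2)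
    (hm' : ∀ a, m' a ≤ m a + 2) :
    ‖weightedAverage m F - weightedAverage m' F‖ ≤ 2 * T.card * R * (N : ℝ)⁻¹ := by
  obtain ⟨a₀, ha₀⟩ := hpos
  have hN0 : (0 : ℝ) < N := by exact_mod_cast hN
  have hNS : (N : ℝ) ≤ ∑ a ∈ T, (m a : ℝ) :=
    le_trans (by exact_mod_cast ha₀) (Finset.single_le_sum (f := fun a => (m a : ℝ))
      (fun a _ => by positivity) (hT a₀ (hN.trans_le ha₀)))
  have h0 := sum_smul_sub_weightedAverage (F := F) hT ⟨a₀, hN.trans_le ha₀⟩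
  have h0' := sum_smul_sub_weightedAverage (F := F) hT' hpos'
  set w := weightedAverage m F
  set w' := weightedAverage m' F with hw'
  have h1 : (∑ a ∈ T, (m a : ℝ)) • (w - w') =
      ∑ a ∈ T, ((m a : ℝ) - m' a) • (F a - w') := by
    simp only [sub_smul, Finset.sum_sub_distrib]
    rw [h0', sub_zero, Finset.sum_smul, ← sub_eq_zero, ← Finset.sum_sub_distrib,
      ← neg_eq_zero, ← h0, ← Finset.sum_neg_distrib]
    refine Finset.sum_congr rfl fun a _ => ?_
    rw [← smul_sub, ← smul_neg]
    congr 1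
    abel
  have hR0 : 0 ≤ R := (norm_nonneg _).trans (hR a₀ (hT a₀ (hN.trans_le ha₀)) a₀
    (hT a₀ (hN.trans_le ha₀)))
  have h2 : ‖∑ a ∈ T, ((m a : ℝ) - m' a) • (F a - w')‖ ≤ T.card * (2 * R) := by
    rw [← nsmul_eq_mul, ← Finset.sum_const]
    refine norm_sum_le_of_le _ fun a ha => ?_
    rw [norm_smul, Real.norm_eq_abs]
    have e1 : |(m a : ℝ) - m' a| ≤ 2 := by
      have h3 : (m a : ℝ) ≤ m' a + 2 := by exact_mod_cast hm a
      have h4 : (m' a : ℝ) ≤ m a + 2 := by exact_mod_cast hm' a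
      rw [abs_le]; constructor <;> linarith
    have e2 : ‖F a - w'‖ ≤ R :=
      norm_sub_weightedAverage_le hT' hpos' _ fun a' ha' => hR a ha a' (hT' a' ha')
    gcongr
  rw [← h1, norm_smul, Real.norm_of_nonneg (by linarith)] at h2
  rw [← div_eq_mul_inv, le_div_iff₀ hN0]
  have := mul_le_mul_of_nonneg_right hNS (norm_nonneg (w - w'))
  linarith

end WeightedAverage

/-! ### The coordinates carrying the maps of the pieces -/

namespace SPQR

variable {X : Type u} {I : Type v} {G : SimpleGraph X} {e : X}

/-- Starting points of geodesics entering `A` at `a`. -/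
def entersAt (e : X) (G : SimpleGraph X) (A : Set X) (a : X) : Set X :=
  {y | ∃ g : GeodesicTo G e, g.start = y ∧ IsEntry g A a}

/-- The displacement from `o` to `a` in terms of the map `ψ`, if it is at least `3 K`. -/
noncomputable def displacement (G : SimpleGraph X) (K : ℕ) {V : Type*} [AddCommGroup V]
    (A : Set X) (ψ : A → V) (o a : X) : V :=
  open Classical in
  if h : a ∈ A ∧ o ∈ A ∧ 3 * K ≤ G.dist o a then ψ ⟨a, h.1⟩ - ψ ⟨o, h.2.1⟩ else 0

variable {A : I → Set X} {K : ℕ} {b : I → X} {W : ℕ} {V : I → Type*}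
  [∀ i, NormedAddCommGroup (V i)] [∀ i, NormedSpace ℝ (V i)]

/-- The contribution of the piece `A i` to the embedding: an average of displacements at entry
points. -/
noncomputable def pieceMap (G : SimpleGraph X) (e : X) (A : I → Set X) (K : ℕ) (b : I → X) (W : ℕ)
    (ψ : ∀ i, A i → V i) (i : I) (x : X) : V i :=
  weightedAverage (fun a => radiusCount G W (A i) (entersAt e G (A i) a) ∅ x)
    (displacement G K (A i) (ψ i) (b i))

lemma radiusCount_empty_of_mem {A S : Set X} {x : X} (h : x ∈ S) :
    radiusCount G W A S ∅ x = window G W A x := by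
  rw [radiusCount, truncDist_eq_zero G _ h, Nat.sub_zero]
  simp [truncDist]

lemma le_of_displacement_ne_zero {V : Type*} [AddCommGroup V] {A : Set X} {ψ : A → V} {o a : X}
    (h : displacement G K A ψ o a ≠ 0) : 3 * K ≤ G.dist o a := by
  classical
  unfold displacement at h
  split_ifs at h with h'
  · exact h'.2.2
  · exact absurd rfl h

lemma norm_displacement_sub {V : Type*} [NormedAddCommGroup V] {A : Set X} {ψ : A → V}
    (hψ : ∀ x y : A, ‖ψ x - ψ y‖ ≤ G.dist (x : X) y) {o a : X} (ho : o ∈ A) (ha : a ∈ A) :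
    ‖displacement G K A ψ o a - (ψ ⟨a, ha⟩ - ψ ⟨o, ho⟩)‖ ≤ 3 * K := by
  classical
  unfold displacement
  split_ifs with h
  · simp
  · rw [zero_sub, norm_neg]
    refine (hψ _ _).trans ?_
    rw [G.dist_comm]
    have : G.dist o a ≤ 3 * K := by
      by_contra hlt
      exact h ⟨ha, ho, by omega⟩
    exact_mod_cast this

lemma norm_displacement_sub_displacement_le {V : Type*} [NormedAddCommGroup V] {A : Set X}
    {ψ : A → V} (hψ : ∀ x y : A, ‖ψ x - ψ y‖ ≤ G.dist (x : X) y) (hc : G.Connected)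
    (o a a' : X) (ha : a ∈ A) (ha' : a' ∈ A) :
    ‖displacement G K A ψ o a - displacement G K A ψ o a'‖ ≤ G.dist a a' + 3 * K := by
  classical
  have h3 := hc.dist_triangle (u := o) (v := a) (w := a')
  have h4 := hc.dist_triangle (u := o) (v := a') (w := a)
  rw [G.dist_comm (u := a')] at h4
  unfold displacement
  split_ifs with h h' h'
  · rw [sub_sub_sub_cancel_right]
    have := hψ ⟨a, h.1⟩ ⟨a', h'.1⟩
    simp only at this
    linarith [show (0 : ℝ) ≤ 3 * K by positivity]
  · have h1 : G.dist o a' < 3 * K := by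
      by_contra hlt
      exact h' ⟨ha', h.2.1, by omega⟩
    rw [sub_zero]
    refine (hψ _ _).trans ?_
    simp only
    rw [G.dist_comm (v := o)]
    have : G.dist o a ≤ G.dist a a' + 3 * K := by omega
    exact_mod_cast this
  · have h1 : G.dist o a < 3 * K := by
      by_contra hlt
      exact h ⟨ha, h'.2.1, by omega⟩
    rw [zero_sub, norm_neg]
    refine (hψ _ _).trans ?_
    simp only
    rw [G.dist_comm (v := o)]
    have : G.dist o a' ≤ G.dist a a' + 3 * K := by omega
    exact_mod_cast this
  · simp
    positivity

namespace PieceBounds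

variable (hP : PieceBounds G A e K b)
include hP

lemma dist_entry_le_of_pos (hW : 5 ≤ W) {i : I} {g : GeodesicTo G e} {c : X}
    (hg : IsEntry g (A i) c) {a : X}
    (h : 0 < radiusCount G W (A i) (entersAt e G (A i) a) ∅ g.start) : G.dist c a ≤ K := by
  obtain ⟨y, ⟨g', rfl, ha⟩, hy, -⟩ := exists_of_radiusCount_pos (by omega) h
  exact hP.entry_near i g g' (near_of_le ((Nat.mul_le_mul_right _ hW).trans hy)) c a hg ha

omit hP in
lemma mem_of_radiusCount_pos (hW : 5 ≤ W) {i : I} {x a : X}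
    (h : 0 < radiusCount G W (A i) (entersAt e G (A i) a) ∅ x) : a ∈ A i := by
  obtain ⟨y, ⟨g', rfl, ha⟩, -⟩ := exists_of_radiusCount_pos (by omega) h
  exact ha.1.2

/-- This is the purpose of the cut-off at 3K: a surviving displacement has its entry point so far
from `b i` that, by (C2), no geodesic from the point itself can miss the piece. Hence `pieceMap`
vanishes at starts of geodesics missing `A i`. -/
lemma exists_entry_of_pieceMap_ne_zero (hW : 5 ≤ W) {ψ : ∀ i, A i → V i} {i : I}
    (g : GeodesicTo G e) (h : pieceMap G e A K b W ψ i g.start ≠ 0) :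
    ∃ c, IsEntry g (A i) c ∧ 2 * K ≤ G.dist (b i) c := by
  have hc := hP.connected
  have : ∃ a, 0 < radiusCount G W (A i) (entersAt e G (A i) a) ∅ g.start ∧
      displacement G K (A i) (ψ i) (b i) a ≠ 0 := by
    by_contra hcon
    push Not at hcon
    exact h (weightedAverage_eq_zero hcon)
  obtain ⟨a, h1, h2⟩ := this
  have h3 := le_of_displacement_ne_zero h2
  obtain ⟨y, ⟨g', rfl, ha⟩, hy, -⟩ := exists_of_radiusCount_pos (by omega) h1
  obtain ⟨c, hcc, hd⟩ := hP.exists_entry_near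
    (near_of_le' hc ((Nat.mul_le_mul_right _ hW).trans hy)) ha (by omega)
  have := hc.dist_triangle (u := b i) (v := c) (w := a)
  rw [G.dist_comm (u := c)] at this
  exact ⟨c, hcc, by omega⟩

/-- The weights at both points live on vertices of `A i` within 2K of c, at most M of them. Their
displacements differ by at most 4K + 3K, the 3K coming from the cut-off. The weight of c at
`g.start` is the whole window, as radius 0 already counts. -/
lemma norm_pieceMap_sub_le (hW : 5 ≤ W) {ψ : ∀ i, A i → V i}
    (hψ : ∀ i, ∀ x y : A i, ‖ψ i x - ψ i y‖ ≤ G.dist (x : X) y) {M : ℕ}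
    (hM : ∀ x : X, CardLE {y | G.dist x y ≤ 2 * K} M) {i : I} {g g' : GeodesicTo G e}
    (hgg : G.dist g.start g'.start ≤ 1) {c : X} (hg : IsEntry g (A i) c)
    (hl : 2 * K ≤ G.dist (b i) c) :
    ‖pieceMap G e A K b W ψ i g.start - pieceMap G e A K b W ψ i g'.start‖ ≤
      14 * M * K * ((window G W (A i) g.start : ℕ) : ℝ)⁻¹ := by
  have hc := hP.connected
  obtain ⟨c', hg', hcc⟩ := hP.exists_entry_near (g' := g') (Or.inr hgg) hg hl
  obtain ⟨hfin, hcard⟩ := hM c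
  have hgg' : G.dist g'.start g.start ≤ 1 := by rwa [G.dist_comm]
  classical
  have hT : ∀ a, a ∈ hfin.toFinset.filter (· ∈ A i) ↔ G.dist c a ≤ 2 * K ∧ a ∈ A i := by simp
  have hTc : ((hfin.toFinset.filter (· ∈ A i)).card : ℝ) ≤ M := by
    refine le_trans ?_ hcard
    rw [Set.ncard_eq_toFinset_card _ hfin]
    exact_mod_cast Finset.card_filter_le _ _
  refine (norm_weightedAverage_sub_le (T := hfin.toFinset.filter (· ∈ A i)) (fun a ha => ?_)
    (fun a ha => ?_) (one_le_window (G := G) W (A i) g.start) ⟨c, ?_⟩ ⟨c', ?_⟩ (R := 7 * K)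
    (fun a ha a' ha' => ?_) (fun a => radiusCount_le_add hc W (by omega) _ _ _ hgg)
    (fun a => radiusCount_le_add hc W (by omega) _ _ _ hgg')).trans ?_
  · have := hP.dist_entry_le_of_pos hW hg ha
    exact (hT a).2 ⟨by omega, mem_of_radiusCount_pos hW ha⟩
  · have h1 := hP.dist_entry_le_of_pos hW hg' ha
    have h2 := hc.dist_triangle (u := c) (v := c') (w := a)
    exact (hT a).2 ⟨by omega, mem_of_radiusCount_pos hW ha⟩
  · have hmem : g.start ∈ entersAt e G (A i) c := ⟨g, rfl, hg⟩
    exact (radiusCount_empty_of_mem hmem).ge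
  · have hmem : g'.start ∈ entersAt e G (A i) c' := ⟨g', rfl, hg'⟩
    rw [radiusCount_empty_of_mem hmem]
    exact one_le_window W (A i) g'.start
  · rw [hT] at ha ha'
    refine (norm_displacement_sub_displacement_le (hψ i) hc _ _ _ ha.2 ha'.2).trans ?_
    have h2 := hc.dist_triangle (u := a) (v := c) (w := a')
    rw [G.dist_comm (u := a) (v := c)] at h2
    have h3 : G.dist a a' + 3 * K ≤ 7 * K := by omega
    exact_mod_cast h3
  · have : (0 : ℝ) ≤ ((window G W (A i) g.start : ℕ) : ℝ)⁻¹ := by positivity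
    refine mul_le_mul_of_nonneg_right ?_ this
    have hK0 : (0 : ℝ) ≤ K := by positivity
    nlinarith

/-- Pieces are sorted by the distance n from x to their entry on one geodesic: at most K of them
share a value of n, and their windows are at least proportional to n + 1, so the sum is dominated by
∑ n^(-p). -/
lemma sum_pieceMap_le (hbg : BoundedGeometry G) (hW : 5 ≤ W) {ψ : ∀ i, A i → V i}
    (hψ : ∀ i, ∀ x y : A i, ‖ψ i x - ψ i y‖ ≤ G.dist (x : X) y) {p : ℝ} (hp : 1 < p) :
    ∃ C : ℝ, 0 ≤ C ∧ ∀ x y, G.Adj x y → ∀ F : Finset I,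
      ∑ i ∈ F, ‖pieceMap G e A K b W ψ i x - pieceMap G e A K b W ψ i y‖ ^ p ≤ C := by
  classical
  have hc := hP.connected
  have hp0 : 0 < p := by linarith
  obtain ⟨M, hM⟩ := hbg (2 * K)
  set D : ℝ := 14 * M * K * ((5 * K * W : ℕ) : ℝ) ^ 2 with hD
  have hD0 : 0 ≤ D := by positivity
  set r : ℕ → ℝ := fun n => D ^ p * ((n + 1 : ℕ) : ℝ)⁻¹ ^ p with hr
  have hr0 : ∀ n, 0 ≤ r n := fun n => by positivity
  have hrs : Summable r := by
    refine Summable.mul_left _ ?_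
    have := (summable_nat_add_iff 1).2 (Real.summable_nat_rpow_inv.2 hp)
    refine this.congr fun n => ?_
    rw [Real.inv_rpow (by positivity)]
  refine ⟨2 * (K * ∑' n, r n), mul_nonneg (by norm_num)
    (mul_nonneg (by positivity) (tsum_nonneg hr0)), fun x y hxy F => ?_⟩
  have hd : G.dist x y ≤ 1 := by rw [SimpleGraph.dist_eq_one_iff_adj.2 hxy]
  obtain ⟨g, rfl⟩ := GeodesicTo.exists_start_eq hc e x
  obtain ⟨g', rfl⟩ := GeodesicTo.exists_start_eq hc e y
  have part : ∀ g g' : GeodesicTo G e, G.dist g.start g'.start ≤ 1 →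
      ∑ i ∈ F.filter (fun i => ∃ c, IsEntry g (A i) c ∧ 2 * K ≤ G.dist (b i) c),
        ‖pieceMap G e A K b W ψ i g.start - pieceMap G e A K b W ψ i g'.start‖ ^ p ≤
      K * ∑' n, r n := by
    intro g g' hgg
    have hex : ∀ i ∈ F.filter (fun i => ∃ c, IsEntry g (A i) c ∧ 2 * K ≤ G.dist (b i) c),
        ∃ c, IsEntry g (A i) c ∧ 2 * K ≤ G.dist (b i) c := fun i hi => (Finset.mem_filter.1 hi).2
    have : Nonempty X := ⟨e⟩
    choose! c hcE hcl using hex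
    refine sum_le_of_fiber _ (fun i => G.dist g.start (c i)) hr0 hrs (fun i hi => ?_) K
      fun n F' hF' hn => ?_
    · simp only [hr]
      rw [← Real.mul_rpow hD0 (by positivity)]
      refine Real.rpow_le_rpow (norm_nonneg _) ?_ hp0.le
      refine (hP.norm_pieceMap_sub_le hW hψ hM hgg (hcE i hi) (hcl i hi)).trans ?_
      rw [hD, mul_assoc (14 * (M : ℝ) * K)]
      refine mul_le_mul_of_nonneg_left ?_ (by positivity)
      refine isDecay_inv.le_of_le_mul (one_le_window _ _ _)
        (Nat.mul_pos (Nat.mul_pos (by norm_num) hP.one_le) (by omega)) ?_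
      have h1 := hP.dist_entry_le (hcE i hi)
      have h2 : distTo G g.start (A i) + 1 ≤ W * window G W (A i) g.start := by
        have := Nat.div_add_mod (distTo G g.start (A i)) W
        have := Nat.mod_lt (distTo G g.start (A i)) (show W > 0 by omega)
        unfold window
        rw [mul_add]
        omega
      have h3 : 5 * K * (distTo G g.start (A i) + 1) ≤ 5 * K * W * window G W (A i) g.start := by
        rw [mul_assoc (5 * K) W]
        exact Nat.mul_le_mul_left _ h2
      have h4 : 1 ≤ K * (distTo G g.start (A i) + 1) := Nat.mul_pos hP.one_le (by omega)
      rw [mul_assoc] at h1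
      rw [mul_assoc 5 K] at h3
      omega
    · have := hP.card_le_of_trace g id F' (Function.injective_id.injOn) (G.dist e g.start - n) 1
        fun i hi => ⟨c i, (hcE i (hF' hi)).1, ?_⟩
      · simpa using this
      · have h1 := (hcE i (hF' hi)).dist_start_add hc
        have h2 := hn i hi
        omega
  have hx := part g g' hd
  have hy := part g' g (by rwa [G.dist_comm])
  have hsplit : ∑ i ∈ F, ‖pieceMap G e A K b W ψ i g.start - pieceMap G e A K b W ψ i g'.start‖ ^ p
      ≤ ∑ i ∈ F.filter (fun i => ∃ c, IsEntry g (A i) c ∧ 2 * K ≤ G.dist (b i) c),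
        ‖pieceMap G e A K b W ψ i g.start - pieceMap G e A K b W ψ i g'.start‖ ^ p +
      ∑ i ∈ F.filter (fun i => ∃ c, IsEntry g' (A i) c ∧ 2 * K ≤ G.dist (b i) c),
        ‖pieceMap G e A K b W ψ i g'.start - pieceMap G e A K b W ψ i g.start‖ ^ p := by
    rw [Finset.sum_filter, Finset.sum_filter, ← Finset.sum_add_distrib]
    refine Finset.sum_le_sum fun i _ => ?_
    rw [norm_sub_rev (pieceMap G e A K b W ψ i g'.start)]
    have h0 : 0 ≤ ‖pieceMap G e A K b W ψ i g.start - pieceMap G e A K b W ψ i g'.start‖ ^ p := by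
      positivity
    by_cases h1 : ∃ c, IsEntry g (A i) c ∧ 2 * K ≤ G.dist (b i) c
    · rw [if_pos h1]
      split_ifs <;> linarith
    · by_cases h2 : ∃ c, IsEntry g' (A i) c ∧ 2 * K ≤ G.dist (b i) c
      · rw [if_neg h1, if_pos h2, zero_add]
      · have h1' := mt (hP.exists_entry_of_pieceMap_ne_zero hW (ψ := ψ) g) h1
        have h2' := mt (hP.exists_entry_of_pieceMap_ne_zero hW (ψ := ψ) g') h2
        rw [not_not] at h1' h2'
        simp [h1', h2', Real.zero_rpow hp0.ne']
  linarith

end PieceBounds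

end SPQR

/-! ### Lower bounds: separating two points -/

namespace SPQR

variable {X : Type u} {I : Type v} {G : SimpleGraph X} {e : X}
variable {A : I → Set X} {K : ℕ} {b : I → X} {W : ℕ}

namespace PieceBounds

section Displacement

variable {V : I → Type*} [∀ i, NormedAddCommGroup (V i)] [∀ i, NormedSpace ℝ (V i)]
variable (hP : PieceBounds G A e K b)
include hP

lemma norm_displacement_sub_pieceMap_le (hbg : BoundedGeometry G) (hW : 5 ≤ W)
    {ψ : ∀ i, A i → V i} (hψ : ∀ i, ∀ x y : A i, ‖ψ i x - ψ i y‖ ≤ G.dist (x : X) y)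
    {i : I} {g : GeodesicTo G e} {c : X} (hg : IsEntry g (A i) c) :
    ‖displacement G K (A i) (ψ i) (b i) c - pieceMap G e A K b W ψ i g.start‖ ≤ 4 * K := by
  obtain ⟨M, hM⟩ := hbg K
  obtain ⟨hfin, -⟩ := hM c
  have hmem : g.start ∈ entersAt e G (A i) c := ⟨g, rfl, hg⟩
  refine norm_sub_weightedAverage_le (T := hfin.toFinset) (fun a ha => ?_) ⟨c, ?_⟩ _
    fun a ha => ?_
  · simpa using hP.dist_entry_le_of_pos hW hg ha
  · rw [radiusCount_empty_of_mem hmem]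
    exact one_le_window W (A i) g.start
  · refine (norm_displacement_sub_displacement_le (hψ i) hP.connected _ _ _ hg.1.2
      (mem_of_radiusCount_pos hW ha)).trans ?_
    have : G.dist c a + 3 * K ≤ 4 * K := by
      have := hP.dist_entry_le_of_pos hW hg ha
      omega
    exact_mod_cast this

lemma norm_sub_le_of_meets (hbg : BoundedGeometry G) (hW : 5 ≤ W) {ψ : ∀ i, A i → V i}
    (hψ : ∀ i, ∀ x y : A i, ‖ψ i x - ψ i y‖ ≤ G.dist (x : X) y)
    {i : I} {g g' : GeodesicTo G e} {c c' : X} (hg : IsEntry g (A i) c)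
    (hg' : IsEntry g' (A i) c') :
    ‖ψ i ⟨c, hg.1.2⟩ - ψ i ⟨c', hg'.1.2⟩‖ ≤
      ‖pieceMap G e A K b W ψ i g.start - pieceMap G e A K b W ψ i g'.start‖ + 14 * K := by
  have ho := hP.base_mem i ⟨c, hg.1.2⟩
  have h1 := norm_displacement_sub (K := K) (hψ i) ho hg.1.2
  have h2 := norm_displacement_sub (K := K) (hψ i) ho hg'.1.2
  have h3 := hP.norm_displacement_sub_pieceMap_le hbg hW hψ hg
  have h4 := hP.norm_displacement_sub_pieceMap_le hbg hW hψ hg'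
  set d := displacement G K (A i) (ψ i) (b i) c
  set d' := displacement G K (A i) (ψ i) (b i) c'
  set v := pieceMap G e A K b W ψ i g.start
  set v' := pieceMap G e A K b W ψ i g'.start
  set r := ψ i ⟨c, hg.1.2⟩
  set r' := ψ i ⟨c', hg'.1.2⟩
  set o := ψ i ⟨b i, ho⟩
  -- Two averaging errors of 4K and two cut-off errors of 3K give 14K.
  have key : r - r' = (v - v') + (d - v) - (d' - v') - (d - (r - o)) + (d' - (r' - o)) := by abel
  rw [key]
  refine (norm_add_le _ _).trans ?_
  have e1 := norm_sub_le ((v - v') + (d - v) - (d' - v')) (d - (r - o))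
  have e2 := norm_sub_le ((v - v') + (d - v)) (d' - v')
  have e3 := norm_add_le (v - v') (d - v)
  linarith

lemma norm_sub_le_of_misses (hbg : BoundedGeometry G) (hW : 5 ≤ W) {ψ : ∀ i, A i → V i}
    (hψ : ∀ i, ∀ x y : A i, ‖ψ i x - ψ i y‖ ≤ G.dist (x : X) y)
    {i : I} {g g' : GeodesicTo G e} {c : X} (hg : IsEntry g (A i) c)
    (hg' : trace g' (A i) = ∅) :
    ‖ψ i ⟨c, hg.1.2⟩ - ψ i ⟨b i, hP.base_mem i ⟨c, hg.1.2⟩⟩‖ ≤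
      ‖pieceMap G e A K b W ψ i g.start - pieceMap G e A K b W ψ i g'.start‖ + 14 * K := by
  have h0 : pieceMap G e A K b W ψ i g'.start = 0 := by
    by_contra hne
    obtain ⟨c, hc, -⟩ := hP.exists_entry_of_pieceMap_ne_zero hW g' hne
    exact hc.trace_ne hg'
  have ho := hP.base_mem i ⟨c, hg.1.2⟩
  have h1 := norm_displacement_sub (K := K) (hψ i) ho hg.1.2
  have h3 := hP.norm_displacement_sub_pieceMap_le hbg hW hψ hg
  rw [h0, sub_zero]
  set d := displacement G K (A i) (ψ i) (b i) c
  set v := pieceMap G e A K b W ψ i g.start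
  set r := ψ i ⟨c, hg.1.2⟩
  set o := ψ i ⟨b i, ho⟩
  have key : r - o = v + (d - v) - (d - (r - o)) := by abel
  rw [key]
  have e1 := norm_sub_le (v + (d - v)) (d - (r - o))
  have e3 := norm_add_le v (d - v)
  have hK : (0 : ℝ) ≤ K := by positivity
  linarith

end Displacement

variable (hP : PieceBounds G A e K b)
include hP

/-- The pieces entered by `g` near its start are missed by `g'`. -/
lemma misses_of_near_start {g g' : GeodesicTo G e} {m : ℕ}
    (hle : G.dist e g'.start ≤ G.dist e g.start) (hD : 10 * m ≤ G.dist g.start g'.start)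
    (h₁ : ∀ i c c', IsEntry g (A i) c → IsEntry g' (A i) c' → G.dist c c' < m)
    {i : I} {c : X} (hg : IsEntry g (A i) c) (hd : G.dist g.start c ≤ 2 * m) :
    trace g' (A i) = ∅ := by
  have hc := hP.connected
  -- If g' entered too, the entries would be less than m apart; as |y| ≤ |x|, the path from x to y
  -- through them would be shorter than 2m + m + 3m.
  by_contra ht
  obtain ⟨c', hc'⟩ := exists_isEntry g' ht
  have h1 := h₁ i c c' hg hc'
  have h2 := hg.dist_start_add hc
  have h3 := hc'.dist_start_add hc
  have h4 := hc.dist_triangle (u := e) (v := c') (w := c)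
  have h5 := hc.dist_triangle (u := g.start) (v := c) (w := g'.start)
  have h6 := hc.dist_triangle (u := c) (v := c') (w := g'.start)
  rw [G.dist_comm (u := c') (v := c)] at h4
  rw [G.dist_comm (u := c') (v := g'.start)] at h6
  omega

lemma window_bounds (hW : 5 ≤ W) {g : GeodesicTo G e} {m : ℕ} (hm : 1 ≤ m) {i : I} {c : X}
    (hg : IsEntry g (A i) c) (h₁ : m ≤ 2 * G.dist g.start c) (h₂ : G.dist g.start c ≤ 2 * m) :
    m ≤ 8 * K * W * window G W (A i) g.start ∧ window G W (A i) g.start ≤ 3 * m := by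
  constructor
  · have h1 := hP.dist_entry_le hg
    have h2 : distTo G g.start (A i) + 1 ≤ W * window G W (A i) g.start := by
      have := Nat.div_add_mod (distTo G g.start (A i)) W
      have := Nat.mod_lt (distTo G g.start (A i)) (show W > 0 by omega)
      unfold window
      rw [mul_add]
      omega
    have h3 : 8 * K * (distTo G g.start (A i) + 1) ≤ 8 * K * W * window G W (A i) g.start := by
      rw [mul_assoc (8 * K) W]
      exact Nat.mul_le_mul_left _ h2
    have h4 : 8 * K * (distTo G g.start (A i) + 1) =
      2 * (4 * K * (distTo G g.start (A i) + 1)) := by ring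
    omega
  · have h1 := distTo_le G g.start hg.1.2
    have h2 := Nat.div_le_self (distTo G g.start (A i)) W
    unfold window
    omega

/-- The piece is missed by g', so `long_support` kills the coordinate at the other point. By `h₂`
its entry c is then within m/4 of the base point, hence not much above level t; with m > 4K this
gives the last condition of `longSet`, so `g.start` itself belongs to that set and every radius
counts. -/
lemma long_coordinate (hW : 5 ≤ W) {g g' : GeodesicTo G e} {m : ℕ} (hm : 4 * K + 1 ≤ m)
    (hle : G.dist e g'.start ≤ G.dist e g.start) (hD : 10 * m ≤ G.dist g.start g'.start)
    (h₁ : ∀ i c c', IsEntry g (A i) c → IsEntry g' (A i) c' → G.dist c c' < m)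
    (h₂ : ∀ i c, IsEntry g (A i) c → trace g' (A i) = ∅ → 4 * G.dist (b i) c < m)
    {i : I} {c : X} (hg : IsEntry g (A i) c) {t : ℕ} (hl : 2 * K ≤ G.dist (b i) c)
    (hb : G.dist e (b i) ≤ t + K) (ht : t ≤ G.dist e c) (hx : t + m ≤ G.dist e g.start)
    (hx' : G.dist e g.start ≤ t + 2 * m) :
    (m ≤ 8 * K * W * window G W (A i) g.start ∧ window G W (A i) g.start ≤ 3 * m) ∧
    radiusCount G W (A i) (longSet G A e K b i t) ∅ g.start = window G W (A i) g.start ∧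
    radiusCount G W (A i) (longSet G A e K b i t) ∅ g'.start = 0 := by
  have hc := hP.connected
  have h3 := hg.dist_start_add hc
  have hmiss := hP.misses_of_near_start hle hD h₁ hg (by omega)
  have h4 := h₂ i c hg hmiss
  have h5 := hc.dist_triangle (u := e) (v := b i) (w := c)
  refine ⟨hP.window_bounds hW (by omega) hg (by omega) (by omega),
    radiusCount_empty_of_mem ⟨g, rfl, c, hg, hl, hb, ht, by omega⟩, ?_⟩
  by_contra hne
  obtain ⟨⟨v, hv, -⟩, -⟩ := hP.long_support hW (Nat.pos_of_ne_zero hne) (g := g') rfl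
  rw [hmiss] at hv
  exact hv

/-- Unless the maps `pieceMap` separate `x` from `y`, for each level in a certain range there is
a coordinate which is large at `x` and vanishes at `y`. -/
lemma exists_coordinate {K₀ : ℝ} (hK : (K : ℝ) ≤ K₀) (hK' : K₀ < K + 1)
    {g g' : GeodesicTo G e} {m : ℕ} (hm : 4 * K + 1 ≤ m)
    (hle : G.dist e g'.start ≤ G.dist e g.start) (hD : 10 * m ≤ G.dist g.start g'.start)
    (h₁ : ∀ i c c', IsEntry g (A i) c → IsEntry g' (A i) c' → G.dist c c' < m)
    (h₂ : ∀ i c, IsEntry g (A i) c → trace g' (A i) = ∅ → 4 * G.dist (b i) c < m)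
    {t₀ : ℕ} (hx : t₀ + m + 3 * K ≤ G.dist e g.start) (hx' : G.dist e g.start ≤ t₀ + 2 * m) :
    ∃ (i : I) (t : ℕ), t₀ ≤ t ∧ t ≤ t₀ + 3 * K ∧
      (m ≤ 8 * K * (120 * K) * window G (120 * K) (A i) g.start ∧
        window G (120 * K) (A i) g.start ≤ 3 * m) ∧
      ((window G (120 * K) (A i) g.start ≤
          2 * radiusCount G (120 * K) (A i) (longSet G A e K b i t) ∅ g.start ∧
        radiusCount G (120 * K) (A i) (longSet G A e K b i t) ∅ g'.start = 0) ∨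
      (window G (120 * K) (A i) g.start ≤
          2 * radiusCount G (120 * K) (A i) (entrySet G A e K₀ i t) (forbidSet G A e K₀ t)
            g.start ∧
        radiusCount G (120 * K) (A i) (entrySet G A e K₀ i t) (forbidSet G A e K₀ t)
          g'.start = 0)) := by
  have hc := hP.connected
  have hK1 := hP.one_le
  have hW : 5 ≤ 120 * K := by omega
  have hW0 : 0 < 120 * K := by omega
  obtain ⟨v, hv, hvt⟩ := g.exists_mem_dist_eq hc (t := t₀) (by omega)
  obtain ⟨i, hi⟩ := hP.cover v
  have hvi : v ∈ trace g (A i) := ⟨hv, hi⟩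
  obtain ⟨a, ha⟩ := exists_isEntry g (Set.nonempty_iff_ne_empty.1 ⟨v, hvi⟩)
  obtain ⟨z, hz⟩ := ha.exists_isExit
  have hta := ha.2 v hvi
  have htz := hz.2 v hvi
  have hbz := (hP.dist_exit hz).2
  -- If the entry of the piece through level t₀ is far from its base point, the long coordinate at
  -- t₀ works. Otherwise the segment has length less than 3K, and t₀ is replaced by the entry level.
  rcases le_or_gt (2 * K) (G.dist (b i) a) with hl | hl
  · obtain ⟨hw, hcx, hcy⟩ := hP.long_coordinate hW hm hle hD h₁ h₂ ha (t := t₀) hl (by omega)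
      (by omega) (by omega) hx'
    exact ⟨i, t₀, le_rfl, by omega, hw, Or.inl ⟨by omega, hcy⟩⟩
  have hza := (hP.dist_base_le hz a).2
  have haz := ha.dist_isExit hc hz
  have has := ha.dist_start_add hc
  set t := G.dist e a with ht
  have htt : t ≤ t₀ + 3 * K := by omega
  -- If forbidding geodesics start only beyond half the window, at least half of the radii count for
  -- the entry coordinate.
  by_cases hτ : window G (120 * K) (A i) g.start ≤
      2 * truncDist G (window G (120 * K) (A i) g.start) g.start (forbidSet G A e K₀ t)
  · refine ⟨i, t, by omega, htt, hP.window_bounds hW (by omega) ha (by omega) (by omega),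
      Or.inr ⟨?_, ?_⟩⟩
    · have hmem : g.start ∈ entrySet G A e K₀ i t := by
        refine ⟨?_, g, rfl, a, ha, rfl⟩
        have h1 : 5 * K + 5 ≤ t := by
          have := hc.dist_triangle (u := g.start) (v := e) (w := g'.start)
          rw [G.dist_comm (u := g.start) (v := e)] at this
          omega
        have h2 : (5 * K + 5 : ℝ) ≤ t := by exact_mod_cast h1
        linarith
      rw [radiusCount, truncDist_eq_zero G _ hmem]
      omega
    -- Suppose the coordinate is active at the other point. As g' misses the piece, the nearby g₁
    -- has a short segment there, so its entry is close to `b i` and hence to a. Since both entries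
    -- are at level t, this puts the two starting points too close together.
    · by_contra hne
      obtain ⟨y', ⟨-, g₁, rfl, a', ha', hat⟩, hd, -⟩ :=
        exists_of_radiusCount_pos hW0 (Nat.pos_of_ne_zero hne)
      have hmiss := hP.misses_of_near_start hle hD h₁ ha (by omega)
      obtain ⟨z', hz'⟩ := ha'.exists_isExit
      have hd5 : 5 * G.dist g'.start g₁.start ≤ distTo G g'.start (A i) :=
        (Nat.mul_le_mul_right _ hW).trans hd
      have hd120 : 120 * G.dist g'.start g₁.start ≤ distTo G g'.start (A i) :=
        (Nat.mul_le_mul_right _ (by omega)).trans hd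
      have h3 := hP.length_le i g₁ g' (near_of_le' hc hd5) hmiss z' a' hz' ha'
      have h4 := (hP.dist_base_le hz' a').1
      have h5 := ha'.dist_start_add hc
      have h6 := hc.dist_triangle (u := e) (v := g'.start) (w := g₁.start)
      have h7 := hc.dist_triangle (u := a) (v := b i) (w := a')
      have h8 := hc.dist_triangle (u := g.start) (v := a) (w := a')
      have h9 := hc.dist_triangle (u := g.start) (v := a') (w := g₁.start)
      have h10 := hc.dist_triangle (u := g.start) (v := g₁.start) (w := g'.start)
      have h11 := distTo_le G g'.start ha'.1.2
      have h12 := hc.dist_triangle (u := g'.start) (v := g₁.start) (w := a')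
      rw [G.dist_comm (u := a) (v := b i)] at h7
      rw [G.dist_comm (u := a') (v := g₁.start)] at h9
      rw [G.dist_comm (u := g₁.start) (v := g'.start)] at h10
      omega
  · have hτ' : truncDist G (window G (120 * K) (A i) g.start) g.start (forbidSet G A e K₀ t) <
        window G (120 * K) (A i) g.start := by omega
    obtain ⟨y', ⟨g₁, rfl, j, z₁, c, hz₁, hc₁, -, hmem⟩, -, hd⟩ :=
      exists_of_truncDist_lt_window hW0 hτ'
    have hlo : G.dist e z₁ + 2 * K ≤ t := by
      have : (G.dist e z₁ : ℝ) + 2 * K ≤ t := by linarith [hmem.1]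
      exact_mod_cast this
    have hhi : t + 2 * K ≤ G.dist e c := by
      have : (t : ℝ) + 2 * K ≤ G.dist e c := by linarith [hmem.2]
      exact_mod_cast this
    have hbz₁ := (hP.dist_exit hz₁).2
    set k := G.dist g.start g₁.start with hk
    -- A forbidding geodesic g₁ starts near x, with t in the middle of its segment in `A j`. If (C2)
    -- applies, g inherits this entry and the long coordinate (j, t) works.
    by_cases hnear : Near G (A j) g₁.start g.start
    · have h3 := hc.dist_triangle (u := e) (v := b j) (w := c)
      obtain ⟨c', hc', hcc⟩ := hP.exists_entry_near hnear hc₁ (by omega)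
      have h4 := hc.dist_triangle (u := e) (v := b j) (w := c')
      have h5 := hc.dist_triangle (u := e) (v := c') (w := c)
      rw [G.dist_comm (u := c')] at h5
      obtain ⟨hw, hcx, hcy⟩ := hP.long_coordinate hW hm hle hD h₁ h₂ hc' (t := t) (by omega)
        (by omega) (by omega) (by omega) (by omega)
      exact ⟨j, t, by omega, htt, hw, Or.inl ⟨by omega, hcy⟩⟩
    -- Otherwise `A j` is within 5k of x, so g₁ enters it within O(Kk) of its start. The window
    -- constant 120K makes this small compared with the depth of t below x, which is at least m. The
    -- segment is thus long enough to survive k applications of (C2), and g enters `A j` farther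
    -- than m/4 from its base point, against `h₂`.
    · exfalso
      have hk2 : 2 ≤ k := by
        by_contra hlt
        exact hnear (Or.inr (by rw [G.dist_comm]; omega))
      have hnj : distTo G g.start (A j) < 5 * k := by
        by_contra hge
        exact hnear (near_of_le' hc (by omega))
      have h3 := distTo_le_add hc (A j) g₁.start g.start
      rw [G.dist_comm (u := g₁.start), ← hk] at h3
      have h4 := hP.dist_entry_le hc₁
      have h5 : 4 * K * (distTo G g₁.start (A j) + 1) ≤ 4 * K * (6 * k) :=
        Nat.mul_le_mul_left _ (by omega)
      have h6 : 4 * K * (6 * k) = 24 * (K * k) := by ring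
      have h7 : 120 * K * k = 120 * (K * k) := by ring
      have h8 : K ≤ K * k := Nat.le_mul_of_pos_right _ (by omega)
      have h9 : k ≤ K * k := Nat.le_mul_of_pos_left _ hK1
      have h10 := hc₁.dist_start_add hc
      have h11 := hc.dist_triangle (u := e) (v := g₁.start) (w := g.start)
      rw [G.dist_comm (u := g₁.start), ← hk] at h11
      have h12 := hc₁.dist_isExit hc hz₁
      have h13 : 2 * K * k = 2 * (K * k) := by ring
      have h14 := distTo_le G g.start ha.1.2
      rw [h7] at hd
      have hk' : G.dist g₁.start g.start = k := by rw [G.dist_comm]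
      obtain ⟨c', z', hc', hz', h15, h16⟩ :=
        hP.exists_entry_of_long k hk' hc₁ hz₁ (by omega)
      have h17 := hc.dist_triangle (u := g.start) (v := g₁.start) (w := c')
      have h18 := hc.dist_triangle (u := g₁.start) (v := c) (w := c')
      have h19 := hP.misses_of_near_start hle hD h₁ hc' (by omega)
      have h20 := h₂ j c' hc' h19
      have h21 := (hP.dist_base_le hz' c').2
      omega

end PieceBounds

end SPQR

/-! ### Concave functions and the weights they define -/

section Concave

/-- Slopes decrease and s 0 ≥ 0, so the last slope is at most the average slope from 0. -/
lemma concave_seq {s : ℕ → ℝ} (h0 : ∀ n, 0 ≤ s n)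
    (h : ∀ n, s (n + 2) - s (n + 1) ≤ s (n + 1) - s n) (n : ℕ) :
    n * (s (n + 1) - s n) ≤ s n ∧ s (n + 1) - s n ≤ s 1 ∧ s (n + 1) ≤ (n + 1) * s 1 := by
  induction n with
  | zero => simp [h0]
  | succ n ih =>
    obtain ⟨h1, h2, h3⟩ := ih
    have h4 := h n
    push_cast
    refine ⟨?_, by linarith, by linarith⟩
    nlinarith

namespace IsConcaveFun

lemma le_nsmul {S : Type*} [AddCommMonoid S] [Preorder S] {f : S → ℝ≥0} (hf : IsConcaveFun f)
    {k : ℕ} (hk : 1 ≤ k) (d : S) : (f (k • d) : ℝ) ≤ k * f d := by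
  obtain ⟨k, rfl⟩ := Nat.exists_eq_add_of_le' hk
  have := (concave_seq (s := fun n => (f (n • d) : ℝ)) (fun n => NNReal.coe_nonneg _)
    (fun n => by
      have := hf.concave (n • d) d
      rwa [← succ_nsmul, ← succ_nsmul] at this) k).2.2
  simpa using this

lemma mul_le_succ_mul {f : ℕ → ℝ≥0} (hf : IsConcaveFun f) (n : ℕ) :
    (n : ℝ) * f (n + 1) ≤ (n + 1) * f n := by
  have := (concave_seq (s := fun n => (f n : ℝ)) (fun n => NNReal.coe_nonneg _)
    (fun n => hf.concave n 1) n).1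
  linarith

lemma add {S : Type*} [AddCommMonoid S] [Preorder S] {f g : S → ℝ≥0} (hf : IsConcaveFun f)
    (hg : IsConcaveFun g) : IsConcaveFun fun n => f n + g n where
  mono := hf.mono.add hg.mono
  concave k m := by
    have := hf.concave k m
    have := hg.concave k m
    push_cast
    linarith

end IsConcaveFun

lemma isConcaveFun_sqrt : IsConcaveFun fun n : ℕ => NNReal.sqrt n where
  mono m n h := NNReal.sqrt_le_sqrt.2 (by exact_mod_cast h)
  concave k m := by
    simp only [Real.coe_sqrt, NNReal.coe_natCast]
    push_cast
    have h1 := Real.sq_sqrt (show (0 : ℝ) ≤ k + m by positivity)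
    have h2 := Real.sq_sqrt (show (0 : ℝ) ≤ k + m + m by positivity)
    have h3 := Real.sq_sqrt (show (0 : ℝ) ≤ k by positivity)
    have : √((k : ℝ) + m + m) + √k ≤ 2 * √((k : ℝ) + m) := by
      refine abs_le_of_sq_le_sq' ?_ (by positivity) |>.2
      nlinarith [sq_nonneg (√((k : ℝ) + m + m) - √k)]
    linarith

lemma propertyC_sqrt {p : ℝ} (hp : 1 < p) : PropertyC p fun n : ℕ => NNReal.sqrt n := by
  have h := (summable_nat_add_iff 1).2 (Real.summable_nat_rpow_inv.2
    (show 1 < 1 + p / 2 by linarith))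
  refine h.congr fun n => ?_
  have hn : (0 : ℝ) < ((n + 1 : ℕ) : ℝ) := by positivity
  have e1 : ((n : ℝ) + 1) = ((n + 1 : ℕ) : ℝ) := by push_cast; rfl
  simp only [Real.coe_sqrt, NNReal.coe_natCast]
  rw [e1, Real.sqrt_div_self, one_div, Real.rpow_add hn,
    Real.rpow_one, mul_inv]
  congr 1
  rw [Real.inv_rpow (by positivity), Real.sqrt_eq_rpow, ← Real.rpow_mul hn.le]
  congr 2
  ring

lemma PropertyC.add {p : ℝ} (hp : 1 < p) {f g : ℕ → ℝ≥0} (hf : PropertyC p f)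
    (hg : PropertyC p g) : PropertyC p fun n => f n + g n := by
  refine Summable.of_nonneg_of_le (fun n => by positivity) (fun n => ?_)
    ((Summable.add hf hg).mul_left (2 ^ (p - 1)))
  have h0 : (0 : ℝ) ≤ 1 / ((n : ℝ) + 1) := by positivity
  have hc := NNReal.rpow_add_le_mul_rpow_add_rpow (f (n + 1) / (n + 1)) (g (n + 1) / (n + 1)) hp.le
  have hc' : ((f (n + 1) : ℝ) / (n + 1) + (g (n + 1) : ℝ) / (n + 1)) ^ p ≤
      2 ^ (p - 1) * (((f (n + 1) : ℝ) / (n + 1)) ^ p + ((g (n + 1) : ℝ) / (n + 1)) ^ p) := by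
    exact_mod_cast hc
  push_cast
  rw [add_div]
  refine (mul_le_mul_of_nonneg_left hc' h0).trans (le_of_eq ?_)
  ring

/-- The weights attached to a concave function. -/
noncomputable def decayWeight (p : ℝ) (f : ℕ → ℝ≥0) (n : ℕ) : ℝ :=
  (f n : ℝ) / n * ((n : ℝ) ^ (1 / p))⁻¹

/-- By concavity f(n)/n decreases, and n² times the weight is f(n) n^(1 - 1/p), which increases
because p > 1. -/
lemma isDecay_decayWeight {p : ℝ} (hp : 1 < p) {f : ℕ → ℝ≥0} (hf : IsConcaveFun f) :
    IsDecay (decayWeight p f) where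
  nonneg n := by unfold decayWeight; positivity
  anti n hn := by
    have hn0 : (0 : ℝ) < n := by exact_mod_cast hn
    have h1 := hf.mul_le_succ_mul n
    have h2 : (f (n + 1) : ℝ) / (n + 1 : ℕ) ≤ f n / n := by
      rw [div_le_div_iff₀ (by positivity) hn0]
      push_cast
      linarith
    unfold decayWeight
    have hp0 : 0 ≤ 1 / p := by positivity
    gcongr
    linarith
  mono n hn := by
    have hn0 : (0 : ℝ) < n := by exact_mod_cast hn
    have key : ∀ k : ℕ, 0 < (k : ℝ) →
        (k : ℝ) ^ 2 * decayWeight p f k = f k * (k : ℝ) ^ (1 - 1 / p) := by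
      intro k hk
      rw [Real.rpow_sub hk, Real.rpow_one]
      unfold decayWeight
      have := Real.rpow_pos_of_pos hk (1 / p)
      field_simp
    have hs := key (n + 1) (by positivity)
    push_cast at hs
    rw [key n hn0, hs]
    have h1 : (f n : ℝ) ≤ f (n + 1) := by exact_mod_cast hf.mono (Nat.le_succ n)
    have h2 : 0 ≤ 1 - 1 / p := by
      rw [sub_nonneg, div_le_one (by linarith)]
      exact hp.le
    gcongr
    linarith

lemma summable_decayWeight {p : ℝ} (hp : 1 < p) {f : ℕ → ℝ≥0} (hf : PropertyC p f) :
    Summable fun n => decayWeight p f (n + 1) ^ p := by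
  refine hf.congr fun n => ?_
  have hp0 : p ≠ 0 := by positivity
  unfold decayWeight
  rw [Real.mul_rpow (by positivity) (by positivity), Real.inv_rpow (by positivity),
    ← Real.rpow_mul (by positivity), one_div_mul_cancel hp0, Real.rpow_one]
  push_cast
  rw [one_div, mul_comm]

/-- The contribution of `M` coordinates at scale `P * M`. -/
lemma le_of_coordinates {p : ℝ} (hp : 1 < p) {f : ℕ → ℝ≥0} {P M : ℕ} (hP : 1 ≤ P) (hM : 1 ≤ M)
    {c R : ℝ} (hc : 0 < c) (hR : 0 ≤ R)
    (h : M * ((P * M : ℕ) * decayWeight p f (P * M) / c) ^ p ≤ R ^ p) :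
    (f (P * M) : ℝ) ≤ c * P * R := by
  have hp0 : p ≠ 0 := by positivity
  have hP0 : (1 : ℝ) ≤ P := by exact_mod_cast hP
  have hM0 : (0 : ℝ) < M := by exact_mod_cast hM
  have hPM : (0 : ℝ) < ((P * M : ℕ) : ℝ) := by push_cast; positivity
  set m : ℕ := P * M with hm
  have h1 : (m : ℝ) * decayWeight p f m / c = f m / c * ((m : ℝ) ^ (1 / p))⁻¹ := by
    unfold decayWeight
    field_simp
  rw [h1, Real.mul_rpow (by positivity) (by positivity), Real.inv_rpow (by positivity),
    ← Real.rpow_mul hPM.le, one_div_mul_cancel hp0, Real.rpow_one] at h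
  -- The number M of coordinates cancels the factor 1/m up to P; then P ≤ P^p allows a p-th root.
  have h2 : (M : ℝ) * ((f m / c) ^ p * (m : ℝ)⁻¹) = (f m / c) ^ p / P := by
    rw [hm]
    push_cast
    field_simp
  rw [h2] at h
  have h3 : ((f m : ℝ) / c / P) ^ p ≤ (f m / c) ^ p / P := by
    rw [Real.div_rpow (by positivity) (by positivity)]
    have : (P : ℝ) ≤ (P : ℝ) ^ p := by
      simpa using Real.rpow_le_rpow_of_exponent_le hP0 hp.le
    gcongr
  have h4 := (Real.rpow_le_rpow_iff (by positivity) hR (by linarith)).1 (h3.trans h)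
  rw [div_div, div_le_iff₀ (by positivity)] at h4
  linarith

end Concave

/-! ### Reading off ℓ^p norms from coordinates -/

section Assembly

variable {X : Type u} {I : Type v} {G : SimpleGraph X}

lemma sum_sigma_le {p : ℝ} (hp : 0 < p) {Y : I → Type w} [Fact (1 ≤ ENNReal.ofReal p)]
    (v : ∀ i, lp (fun _ : Y i => ℝ) (ENNReal.ofReal p)) {C : ℝ}
    (h : ∀ F : Finset I, ∑ i ∈ F, ‖v i‖ ^ p ≤ C) (F : Finset (Σ i, Y i)) :
    ∑ z ∈ F, |v z.1 z.2| ^ p ≤ C := by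
  classical
  have hpr : (ENNReal.ofReal p).toReal = p := ENNReal.toReal_ofReal hp.le
  have hsub : F ⊆ (F.image Sigma.fst).sigma
      fun i => F.preimage (Sigma.mk i) (sigma_mk_injective.injOn) := by
    intro z hz
    simp only [Finset.mem_sigma, Finset.mem_preimage, Finset.mem_image]
    exact ⟨⟨z, hz, rfl⟩, hz⟩
  refine (Finset.sum_le_sum_of_subset_of_nonneg hsub fun z _ _ => by positivity).trans ?_
  rw [Finset.sum_sigma]
  refine (Finset.sum_le_sum fun i _ => ?_).trans (h (F.image Sigma.fst))
  have := lp.sum_rpow_le_norm_rpow (by rw [hpr]; exact hp) (v i)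
    (F.preimage (Sigma.mk i) (sigma_mk_injective.injOn))
  simpa [hpr, Real.norm_eq_abs] using this

lemma norm_le_of_coordinates {p : ℝ} (hp : 0 < p) {Y Z : Type*} [Fact (1 ≤ ENNReal.ofReal p)]
    (v : lp (fun _ : Y => ℝ) (ENNReal.ofReal p)) (w : lp (fun _ : Z => ℝ) (ENNReal.ofReal p))
    (ι : Y ↪ Z) (h : ∀ y, w (ι y) = v y) : ‖v‖ ≤ ‖w‖ := by
  have hpr : (ENNReal.ofReal p).toReal = p := ENNReal.toReal_ofReal hp.le
  have hp' : 0 < (ENNReal.ofReal p).toReal := by rwa [hpr]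
  refine lp.norm_le_of_forall_sum_le hp' (norm_nonneg _) fun s => ?_
  have := lp.sum_rpow_le_norm_rpow hp' w (s.map ι)
  rw [Finset.sum_map] at this
  simpa [h] using this

lemma card_mul_rpow_le {p : ℝ} (hp : 0 < p) {Z : Type*} [Fact (1 ≤ ENNReal.ofReal p)]
    (w : lp (fun _ : Z => ℝ) (ENNReal.ofReal p)) (M : ℕ) (z : ℕ → Z)
    (hz : Set.InjOn z (Finset.range M)) {r : ℝ} (hr : 0 ≤ r)
    (h : ∀ l < M, r ≤ |w (z l)|) : M * r ^ p ≤ ‖w‖ ^ p := by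
  classical
  have hpr : (ENNReal.ofReal p).toReal = p := ENNReal.toReal_ofReal hp.le
  have := lp.sum_rpow_le_norm_rpow (by rwa [hpr]) w ((Finset.range M).image z)
  rw [Finset.sum_image hz, hpr] at this
  refine le_trans ?_ this
  calc (M : ℝ) * r ^ p = ∑ l ∈ Finset.range M, r ^ p := by simp
    _ ≤ _ := Finset.sum_le_sum fun l hl =>
      Real.rpow_le_rpow hr (h l (Finset.mem_range.1 hl)) hp.le

/-- A coordinate with a count comparable to its window is large. -/
lemma le_abs_coordinate {q : ℕ → ℝ} (hq : IsDecay q) {m N s c : ℕ} (hc : 1 ≤ c) (hN : 1 ≤ N)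
    (hm : 1 ≤ m) (h₁ : m ≤ c * N) (h₂ : N ≤ 3 * m) (hs : N ≤ 2 * s) :
    (m : ℝ) * q m / (18 * c) ≤ |q N * s| := by
  have hc0 : (0 : ℝ) < c := by exact_mod_cast hc
  have hm0 : (0 : ℝ) < m := by exact_mod_cast hm
  have h3 := hq.monotone hm (show m ≤ 3 * m by omega)
  have h4 := hq.antitone hN h₂
  -- The 9 is 3², the price of N ≤ 3m; with the 2 from `hs` it makes the 18.
  have h5 : q m ≤ 9 * q N := by
    push_cast at h3
    have : (m : ℝ) ^ 2 * q m ≤ (m : ℝ) ^ 2 * (9 * q N) := by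
      calc _ ≤ _ := h3
        _ = (m : ℝ) ^ 2 * (9 * q (3 * m)) := by ring
        _ ≤ _ := by gcongr
    exact le_of_mul_le_mul_left this (by positivity)
  have h6 : (m : ℝ) ≤ 2 * c * s := by
    have : m ≤ 2 * c * s := by
      calc m ≤ c * N := h₁
        _ ≤ c * (2 * s) := Nat.mul_le_mul_left _ hs
        _ = 2 * c * s := by ring
    exact_mod_cast this
  rw [abs_of_nonneg (mul_nonneg (hq.nonneg _) (Nat.cast_nonneg _)), div_le_iff₀ (by positivity)]
  calc (m : ℝ) * q m ≤ (2 * c * s) * (9 * q N) := by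
        have := hq.nonneg m
        gcongr
    _ = _ := by ring

end Assembly

/-! ### The assembled embedding and its lower bound -/

namespace SPQR

/-- The coordinates of the embedding. -/
noncomputable def coordinates {X : Type u} {I : Type v} (G : SimpleGraph X) (e : X) (A : I → Set X)
    (K₀ : ℝ) (K : ℕ) (b : I → X) {p : ℝ} [Fact (1 ≤ ENNReal.ofReal p)] {Y : I → Type w}
    (ψ : ∀ i : I, A i → lp (fun _ : Y i => ℝ) (ENNReal.ofReal p)) (q : ℕ → ℝ) (x : X) :
    ULift.{u} ((Σ i, Y i) ⊕ (I × ℕ) ⊕ (I × ℕ)) → ℝ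
  | ⟨.inl z⟩ => pieceMap G e A K b (120 * K) ψ z.1 x z.2
  | ⟨.inr (.inl j)⟩ => q (window G (120 * K) (A j.1) x) *
      radiusCount G (120 * K) (A j.1) (longSet G A e K b j.1 j.2) ∅ x
  | ⟨.inr (.inr j)⟩ => q (window G (120 * K) (A j.1) x) *
      radiusCount G (120 * K) (A j.1) (entrySet G A e K₀ j.1 j.2) (forbidSet G A e K₀ j.2) x

namespace PieceBounds

variable {X : Type u} {I : Type v} {G : SimpleGraph X} {e : X} {A : I → Set X} {K : ℕ}
  {b : I → X}

variable (hP : PieceBounds G A e K b) {K₀ : ℝ} {p : ℝ} [Fact (1 ≤ ENNReal.ofReal p)]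
  {Y : I → Type w} {ψ : ∀ i : I, A i → lp (fun _ : Y i => ℝ) (ENNReal.ofReal p)}
include hP

lemma sum_coordinates_le (hbg : BoundedGeometry G) (hK : (K : ℝ) ≤ K₀) (hK' : K₀ < K + 1)
    (h4 : C4 G e A K₀) (hp : 1 < p)
    (hψ : ∀ i, ∀ x y : A i, ‖ψ i x - ψ i y‖ ≤ G.dist (x : X) y) {q : ℕ → ℝ} (hq : IsDecay q)
    (hs : Summable fun n => q (n + 1) ^ p) :
    ∃ C : ℝ, 0 ≤ C ∧ ∀ x y, G.Adj x y → ∀ F,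
      ∑ z ∈ F, |coordinates G e A K₀ K b ψ q x z - coordinates G e A K₀ K b ψ q y z| ^ p ≤ C := by
  have hp0 : 0 < p := by linarith
  have hW : 5 ≤ 120 * K := by have := hP.one_le; omega
  obtain ⟨C₁, hC₁, h₁⟩ := hP.sum_pieceMap_le hbg hW hψ hp
  obtain ⟨C₂, hC₂, h₂⟩ := hP.sum_long_le hW hq hp0 hs
  obtain ⟨C₃, hC₃, h₃⟩ := hP.sum_entry_le hW hK hK' h4 hq hp0 hs
  refine ⟨C₁ + (C₂ + C₃), by positivity, fun x y hxy F => ?_⟩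
  have hF : F = (F.map Equiv.ulift.toEmbedding).map Equiv.ulift.symm.toEmbedding := by
    ext z
    simp
  rw [hF, Finset.sum_map, Finset.sum_sum_eq_sum_toLeft_add_sum_toRight,
    Finset.sum_sum_eq_sum_toLeft_add_sum_toRight]
  refine add_le_add ?_ (add_le_add (h₂ x y hxy _) (h₃ x y hxy _))
  exact sum_sigma_le hp0 (fun i => pieceMap G e A K b (120 * K) ψ i x -
    pieceMap G e A K b (120 * K) ψ i y) (h₁ x y hxy) _

/-- The lower bound for the embedding, for `x` not closer to `e` than `y`. -/
lemma min_le_of_coordinates (hbg : BoundedGeometry G) (hK : (K : ℝ) ≤ K₀) (hK' : K₀ < K + 1)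
    (hp : 1 < p) {ρ' : ℝ≥0 → ℝ≥0} (hρ' : IsConcaveFun ρ')
    (hψ : ∀ (i : I) (x y : A i),
      (ρ' (G.dist (x : X) (y : X) : ℝ≥0) : ℝ) ≤ ‖ψ i x - ψ i y‖ ∧
        ‖ψ i x - ψ i y‖ ≤ (G.dist (x : X) (y : X) : ℝ))
    {f : ℕ → ℝ≥0} (hf : IsConcaveFun f)
    {φ : X → lp (fun _ : ULift.{u} ((Σ i, Y i) ⊕ (I × ℕ) ⊕ (I × ℕ)) => ℝ) (ENNReal.ofReal p)}
    (hφ : ∀ x y z, (φ x - φ y) z = coordinates G e A K₀ K b ψ (decayWeight p f) x z -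
      coordinates G e A K₀ K b ψ (decayWeight p f) y z) :
    ∃ C : ℝ, 0 ≤ C ∧ ∀ x y, G.dist e y ≤ G.dist e x →
      ((min (ρ' (G.dist x y : ℝ≥0)) (f (G.dist x y)) : ℝ≥0) : ℝ) ≤ C * ‖φ x - φ y‖ + C := by
  have hp0 : 0 < p := by linarith
  have hc := hP.connected
  have hK1 := hP.one_le
  have hW : 5 ≤ 120 * K := by omega
  have hq := isDecay_decayWeight hp hf
  set q := decayWeight p f with hqdef
  -- The spacing of the levels: `exists_coordinate` may move a level up by 3K, and P > 3K keeps the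
  -- resulting levels distinct.
  set P := 4 * K + 1 with hPdef
  set c := 8 * K * (120 * K) with hcdef
  have hc1 : 1 ≤ c := Nat.mul_pos (by omega) (by omega)
  refine ⟨80 + 80 * (14 * K) + 20 * (18 * c * P) + f (10 * P), by positivity, fun x y hle => ?_⟩
  set R := ‖φ x - φ y‖ with hR
  have hR0 : 0 ≤ R := norm_nonneg _
  have hfP : (0 : ℝ) ≤ f (10 * P) := NNReal.coe_nonneg _
  have hbound : ∀ r : ℝ, r ≤ 80 * (R + 14 * K) ∨ r ≤ 20 * (18 * c * P * R) ∨ r ≤ f (10 * P) →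
      r ≤ (80 + 80 * (14 * K) + 20 * (18 * c * P) + f (10 * P)) * R +
        (80 + 80 * (14 * K) + 20 * (18 * c * P) + f (10 * P)) := by
    intro r hr
    have e1 : (0 : ℝ) ≤ 80 * (14 * K) := by positivity
    have e2 : (0 : ℝ) ≤ 20 * (18 * c * P) := by positivity
    have e3 := mul_nonneg e1 hR0
    have e4 := mul_nonneg e2 hR0
    have e5 := mul_nonneg hfP hR0
    rcases hr with h | h | h <;> linarith
  apply hbound
  obtain ⟨g, rfl⟩ := GeodesicTo.exists_start_eq hc e x
  obtain ⟨g', rfl⟩ := GeodesicTo.exists_start_eq hc e y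
  set D := G.dist g.start g'.start with hDdef
  rcases lt_or_ge D (10 * P) with hsmall | hlarge
  · refine Or.inr (Or.inr ?_)
    have : min (ρ' D) (f D) ≤ f (10 * P) := (min_le_right _ _).trans (hf.mono hsmall.le)
    exact_mod_cast this
  -- The scale m is a multiple of P with 10m ≤ D ≤ 20m.
  set M := D / (10 * P) with hMdef
  have hM : 1 ≤ M := (Nat.one_le_div_iff (by omega)).2 hlarge
  set m := P * M with hmdef
  have hDm : 10 * m ≤ D := by
    have := Nat.mul_div_le D (10 * P)
    rw [mul_assoc] at this
    exact this
  have hDm' : D ≤ 20 * m := by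
    have h1 := Nat.lt_mul_div_succ D (show 0 < 10 * P by omega)
    have h2 : 10 * P * (D / (10 * P) + 1) = 10 * m + 10 * P := by
      rw [← hMdef, hmdef]; ring
    have h3 : P ≤ m := Nat.le_mul_of_pos_right _ hM
    omega
  have hPm : 4 * K + 1 ≤ m := Nat.le_mul_of_pos_right _ hM
  have hnorm : ∀ i, ‖pieceMap G e A K b (120 * K) ψ i g.start -
      pieceMap G e A K b (120 * K) ψ i g'.start‖ ≤ R := fun i =>
    norm_le_of_coordinates hp0 _ _
      ⟨fun y => ⟨.inl ⟨i, y⟩⟩, fun y y' h => by simpa using h⟩ fun y => by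
        rw [hφ]; rfl
  -- From D ≤ 20m ≤ 80d and concavity, ρ'(D) ≤ 80 ρ'(d).
  have hgain : ∀ d : ℕ, m ≤ 4 * d → (ρ' d : ℝ) ≤ R + 14 * K →
      ((min (ρ' D) (f D) : ℝ≥0) : ℝ) ≤ 80 * (R + 14 * K) := by
    intro d hd h
    have h1 : ρ' D ≤ ρ' (80 • (d : ℝ≥0)) := by
      refine hρ'.mono ?_
      rw [nsmul_eq_mul]
      exact_mod_cast (by omega : D ≤ 80 * d)
    have h2 := hρ'.le_nsmul (k := 80) (by norm_num) (d : ℝ≥0)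
    have h3 : ((min (ρ' D) (f D) : ℝ≥0) : ℝ) ≤ ρ' (80 • (d : ℝ≥0)) := by
      exact_mod_cast (min_le_left _ _).trans h1
    push_cast at h2
    linarith
  by_cases h₁ : ∀ i c c', IsEntry g (A i) c → IsEntry g' (A i) c' → G.dist c c' < m
  swap
  · push Not at h₁
    obtain ⟨i, c, c', hcE, hcE', hcc⟩ := h₁
    refine Or.inl (hgain (G.dist c c') (by omega) ?_)
    have h1 := hP.norm_sub_le_of_meets hbg hW (fun i x y => (hψ i x y).2) hcE hcE'
    have h2 := (hψ i ⟨c, hcE.1.2⟩ ⟨c', hcE'.1.2⟩).1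
    have h3 := hnorm i
    simp only at h2
    linarith
  by_cases h₂ : ∀ i c, IsEntry g (A i) c → trace g' (A i) = ∅ → 4 * G.dist (b i) c < m
  swap
  · push Not at h₂
    obtain ⟨i, c, hcE, ht, hcc⟩ := h₂
    refine Or.inl (hgain (G.dist (b i) c) hcc ?_)
    have h1 := hP.norm_sub_le_of_misses hbg hW (fun i x y => (hψ i x y).2) hcE ht
    have h2 := (hψ i ⟨c, hcE.1.2⟩ ⟨b i, hP.base_mem i ⟨c, hcE.1.2⟩⟩).1
    have h3 := hnorm i
    simp only at h2
    rw [G.dist_comm] at h2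
    linarith
  refine Or.inr (Or.inl ?_)
  have hlev : 5 * m ≤ G.dist e g.start := by
    have h1 := hc.dist_triangle (u := g.start) (v := e) (w := g'.start)
    rw [G.dist_comm (u := g.start) (v := e)] at h1
    omega
  have hlP : ∀ l < M, (l + 1) * P ≤ m := fun l hl => by
    rw [hmdef, mul_comm P]
    exact Nat.mul_le_mul_right _ hl
  -- The M levels |x| - 2m + lP lie between depths m and 2m below x; the natural subtraction is
  -- exact by `hlev`.
  have hex : ∀ l, l < M → ∃ z : ULift.{u} ((Σ i, Y i) ⊕ (I × ℕ) ⊕ (I × ℕ)),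
      (∃ (i : I) (t : ℕ), (z = ⟨.inr (.inl (i, t))⟩ ∨ z = ⟨.inr (.inr (i, t))⟩) ∧
        G.dist e g.start - 2 * m + l * P ≤ t ∧
        t < G.dist e g.start - 2 * m + (l + 1) * P) ∧
      (m : ℝ) * q m / (18 * c) ≤ |(φ g.start - φ g'.start) z| := by
    intro l hl
    have hl1 := hlP l hl
    have hl2 : (l + 1) * P = l * P + P := by ring
    obtain ⟨i, t, ht, ht', ⟨hw₁, hw₂⟩, h⟩ := hP.exists_coordinate hK hK' hPm hle hDm h₁ h₂
      (t₀ := G.dist e g.start - 2 * m + l * P) (by omega) (by omega)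
    rcases h with ⟨hx, hy⟩ | ⟨hx, hy⟩
    · refine ⟨⟨.inr (.inl (i, t))⟩, ⟨i, t, Or.inl rfl, ht, by omega⟩, ?_⟩
      rw [hφ]
      simp only [coordinates]
      rw [hy, Nat.cast_zero, mul_zero, sub_zero]
      exact le_abs_coordinate hq hc1 (one_le_window _ _ _) (by omega) hw₁ hw₂ hx
    · refine ⟨⟨.inr (.inr (i, t))⟩, ⟨i, t, Or.inr rfl, ht, by omega⟩, ?_⟩
      rw [hφ]
      simp only [coordinates]
      rw [hy, Nat.cast_zero, mul_zero, sub_zero]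
      exact le_abs_coordinate hq hc1 (one_le_window _ _ _) (by omega) hw₁ hw₂ hx
  have hne : Nonempty (ULift.{u} ((Σ i, Y i) ⊕ (I × ℕ) ⊕ (I × ℕ))) :=
    ⟨(hex 0 hM).choose⟩
  choose! z hz hzr using hex
  -- Coordinates for different l have their levels in disjoint intervals of length P.
  have hinj : Set.InjOn z (Finset.range M) := by
    intro l hl l' hl' hll
    obtain ⟨i, t, h1, h2, h3⟩ := hz l (Finset.mem_range.1 hl)
    obtain ⟨i', t', h1', h2', h3'⟩ := hz l' (Finset.mem_range.1 hl')
    have htt : t = t' := by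
      rw [hll] at h1
      rcases h1 with h | h <;> rcases h1' with h' | h' <;> rw [h'] at h <;> simp at h
      · exact h.2.symm
      · exact h.2.symm
    subst htt
    have e1 : l * P < (l' + 1) * P := by omega
    have e2 : l' * P < (l + 1) * P := by omega
    have e3 := lt_of_mul_lt_mul_right e1 (Nat.zero_le _)
    have e4 := lt_of_mul_lt_mul_right e2 (Nat.zero_le _)
    omega
  have hqm : 0 ≤ q m := hq.nonneg m
  have hsum := card_mul_rpow_le hp0 (φ g.start - φ g'.start) M z hinj
    (r := (m : ℝ) * q m / (18 * c)) (by positivity) hzr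
  have hfm := le_of_coordinates hp (P := P) (M := M) (by omega) hM (c := 18 * c)
    (by positivity) hR0 hsum
  have h1 := hf.le_nsmul (k := 20) (by norm_num) m
  have h2 : ((min (ρ' D) (f D) : ℝ≥0) : ℝ) ≤ f (20 • m) := by
    have : min (ρ' D) (f D) ≤ f (20 • m) :=
      (min_le_right _ _).trans (hf.mono (by rw [smul_eq_mul]; exact hDm'))
    exact_mod_cast this
  push_cast at h1
  linarith

end PieceBounds

end SPQR

/-- Embeddings of SPQR relatively hyperbolic spaces into `ℓ^p`. -/
theorem IsSPQRRelHyp.exists_lp_embedding {X : Type u} {I : Type v} {G : SimpleGraph X}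
    {A : I → Set X} {e : X} (hX : IsSPQRRelHyp G A e) {p : ℝ} (hp : 1 < p) {Y : I → Type w}
    [Fact (1 ≤ ENNReal.ofReal p)]
    {ψ : ∀ i : I, A i → lp (fun _ : Y i => ℝ) (ENNReal.ofReal p)}
    {ρ' : ℝ≥0 → ℝ≥0} (hρ' : IsConcaveFun ρ')
    (hψ : ∀ (i : I) (x y : A i),
      (ρ' (G.dist (x : X) (y : X) : ℝ≥0) : ℝ) ≤ ‖ψ i x - ψ i y‖ ∧
        ‖ψ i x - ψ i y‖ ≤ (G.dist (x : X) (y : X) : ℝ))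
    {f : ℕ → ℝ≥0} (hf : IsConcaveFun f) (hfC : PropertyC p f) :
    ∃ (Z : Type (max u v w)) (φ : X → lp (fun _ : Z => ℝ) (ENNReal.ofReal p)) (C : ℝ),
      0 ≤ C ∧ ∀ x y : X, ‖φ x - φ y‖ ≤ C * (G.dist x y : ℝ) ∧
        ((min (ρ' (G.dist x y : ℝ≥0)) (f (G.dist x y)) : ℝ≥0) : ℝ) ≤ C * ‖φ x - φ y‖ + C := by
  obtain ⟨K₀, h1, h2, h3, h4⟩ := hX.conditions
  obtain ⟨b, hP⟩ := SPQR.exists_pieceBounds hX.connected h1 h2 h3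
  have hK0 : 0 ≤ K₀ := by
    by_contra hneg
    have := hP.one_le
    rw [Nat.floor_of_nonpos (by linarith)] at this
    omega
  have hK := Nat.floor_le hK0
  have hK' := Nat.lt_floor_add_one K₀
  obtain ⟨C₁, hC₁, hsum⟩ := hP.sum_coordinates_le hX.boundedGeometry hK hK' h4 hp
    (fun i x y => (hψ i x y).2) (isDecay_decayWeight hp hf) (summable_decayWeight hp hfC)
  obtain ⟨φ, hφ, hlip⟩ := exists_lp_map hX.connected hp _ hC₁ hsum
  obtain ⟨C₂, hC₂, hlow⟩ :=
    hP.min_le_of_coordinates hX.boundedGeometry hK hK' hp hρ' hψ hf hφ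
  have hC : 0 ≤ C₁ ^ (1 / p) := by positivity
  refine ⟨_, φ, C₁ ^ (1 / p) + C₂, by positivity, fun x y => ⟨?_, ?_⟩⟩
  · refine (hlip x y).trans ?_
    gcongr
    linarith
  · have key : ((min (ρ' (G.dist x y : ℝ≥0)) (f (G.dist x y)) : ℝ≥0) : ℝ) ≤
        C₂ * ‖φ x - φ y‖ + C₂ := by
      rcases le_total (G.dist e y) (G.dist e x) with h | h
      · exact hlow x y h
      · rw [norm_sub_rev, G.dist_comm]
        exact hlow y x h
    have : 0 ≤ C₁ ^ (1 / p) * ‖φ x - φ y‖ := by positivity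
    linarith

theorem mainTheorem2 {X : Type u} {I : Type v} (G : SimpleGraph X) (A : I → Set X) (e : X)
    (hX : IsSPQRRelHyp G A e) (p : ℝ) (hp : 1 < p)
    (Y : I → Type w) (ψ : ∀ i : I, A i → lp (fun _ : Y i => ℝ) (ENNReal.ofReal p))
    (ρ' : ℝ≥0 → ℝ≥0) (hρ' : IsConcaveFun ρ')
    (hψ : ∀ (i : I) (x y : A i),
      (ρ' (G.dist (x : X) (y : X) : ℝ≥0) : ℝ) ≤ ‖ψ i x - ψ i y‖ ∧
        ‖ψ i x - ψ i y‖ ≤ (G.dist (x : X) (y : X) : ℝ))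
    (f : ℕ → ℝ≥0) (hf : PropertyCc p f) :
    ∃ (Z : Type (max u v w)) (φ : X → lp (fun _ : Z => ℝ) (ENNReal.ofReal p)),
      (∃ C : ℝ, ∀ x y : X,
        ‖φ x - φ y‖ ≤ C * (G.dist x y : ℝ) ∧
        ((min (ρ' (G.dist x y : ℝ≥0)) (f (G.dist x y)) : ℝ≥0) : ℝ) ≤ C * ‖φ x - φ y‖ + C) ∧
      (Tendsto ρ' atTop atTop → IsCoarseEmbedding G φ) := by
  have : Fact (1 ≤ ENNReal.ofReal p) := ⟨by simpa using ENNReal.ofReal_le_ofReal hp.le⟩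
  -- As f may be bounded, √n is added: it is concave, has property (C_p), and makes the lower
  -- control function unbounded whenever ρ' is.
  obtain ⟨Z, φ, C, hC, h⟩ := hX.exists_lp_embedding hp hρ' hψ
    (hf.concave.add isConcaveFun_sqrt) (hf.summable.add hp (propertyC_sqrt hp))
  refine ⟨Z, φ, ⟨C, fun x y => ⟨(h x y).1, le_trans ?_ (h x y).2⟩⟩, fun hρ => ?_⟩
  · have : min (ρ' (G.dist x y : ℝ≥0)) (f (G.dist x y)) ≤
        min (ρ' (G.dist x y : ℝ≥0)) (f (G.dist x y) + NNReal.sqrt (G.dist x y : ℕ)) :=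
      min_le_min le_rfl le_self_add
    exact_mod_cast this
  · set C' : ℝ≥0 := C.toNNReal + 1 with hC'
    have hC'C : C ≤ C' := by
      rw [hC', NNReal.coe_add, Real.coe_toNNReal C hC]
      simp
    have hC'pos : 0 < C' := by rw [hC']; positivity
    -- The lower estimate min ≤ C' ‖·‖ + C' is solved for the norm, with subtraction truncated at 0;
    -- the summand 1 in C' makes the division legitimate.
    refine ⟨fun r => (min (ρ' r) (f ⌊r⌋₊ + NNReal.sqrt (⌊r⌋₊ : ℕ)) - C') / C', fun r => C' * r,
      ?_, ?_, fun x y => ⟨?_, ?_⟩⟩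
    · have hsqrt : Tendsto (fun r : ℝ≥0 => NNReal.sqrt (⌊r⌋₊ : ℕ)) atTop atTop :=
        NNReal.sqrt.tendsto_atTop.comp
          (tendsto_natCast_atTop_atTop.comp tendsto_nat_floor_atTop)
      refine tendsto_atTop.2 fun B => ?_
      filter_upwards [hρ.eventually_ge_atTop (B * C' + C'),
        hsqrt.eventually_ge_atTop (B * C' + C')] with r h1 h2
      rw [le_div_iff₀ hC'pos]
      exact le_tsub_of_add_le_right (le_min h1 (h2.trans le_add_self))
    · exact tendsto_id.const_mul_atTop hC'pos
    · have h2 := (h x y).2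
      simp only [Nat.floor_natCast]
      set n := ‖φ x - φ y‖.toNNReal with hn
      have hn' : ‖φ x - φ y‖ = n := (Real.coe_toNNReal _ (norm_nonneg _)).symm
      rw [hn'] at h2 ⊢
      rw [NNReal.coe_le_coe, div_le_iff₀ hC'pos, tsub_le_iff_right, ← NNReal.coe_le_coe]
      refine h2.trans ?_
      rw [NNReal.coe_add, NNReal.coe_mul, mul_comm]
      gcongr
    · refine (h x y).1.trans ?_
      push_cast
      gcongr
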